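/- **Diagrammatic categories.** Let $n\in\mathbb N_0$. Colors are the integers $1,\dots,n-1$; two colors $i,j$ are adjacent if $|i-j|=1$ and distant if $|i-j|>1$. Let $\mathcal D_n$ be the strict monoidal $\mathbb Z$-graded $\mathbb C$-linear category (monoidal product $\circ_1$: horizontal juxtaposition; composition $\circ_2$: vertical stacking, diagrams read from bottom to top) whose objects are the words $c_{i_1}\circ_1\cdots\circ_1c_{i_k}$ in the generators $c_1,\dots,c_{n-1}$ and whose morphisms are $\mathbb C$-linear combinations of diagrams built from the generators (for all colors $i$; $j$ adjacent, resp. distant, to $i$; $1\le k\le n$) - merge $c_ic_i\to c_i$ and split $c_i\to c_ic_i$, of degree $-1$; startdot $\mathbf 1\to c_i$ and enddot $c_i\to\mathbf 1$, of degree $1$; - six-valent vertex $c_ic_jc_i\to c_jc_ic_j$ ($i,j$ adjacent), of degree $0$; crossing $c_ic_j\to c_jc_i$ ($i,j$ distant), of degree $0$; box $x_k\colon\mathbf 1\to\mathbf 1$, of degree $2$; modulo the tensor ideal generated by the following relations. Boxes labelled by polynomials in $x_1,\dots,x_n$ are the evident combinations; $\mathrm{cap}_i$ is merge followed by enddot,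 $\mathrm{cup}_i$ is startdot followed by split; $s_i$ swaps $x_i,x_{i+1}$, and $\partial_i(p)=(p-s_i(p))/(x_i-x_{i+1})$. 1. (Frobenius) $(c_i,\text{merge},\text{split},\text{startdot},\text{enddot})$ is a Frobenius algebra object. 2. (Isotopy) Diagrams related by planar isotopy relative to the boundary are equal; besides the monoidal interchange law and (1) this amounts to: a six-valent vertex or a crossing rotated by one strand (in either direction, by means of cups and caps) is the six-valent vertex or crossing with the two colors exchanged. 3. (Polynomial forcing, barbell, needle) a box $p$ to the left of a strand $i$ equals the strand with the box $s_i(p)$ to its right plus the broken strand (enddot, then startdot) with the box $\partial_i(p)$ to its right; startdot followed by enddot equals the box $x_i-x_{i+1}$; split followed by $\mathrm{cap}_i$ is $0$. 4. (Compatibilities) For $i,j$ adjacent: the six-valent vertex $c_ic_jc_i\to c_jc_ic_j$ followed by the enddot on $c_i$ equals $\mathrm{cup}_j\circ_2\mathrm{cap}_i\circ_2(\mathrm{id}\circ_1\text{enddot}_j\circ_1\mathrm{id})+\text{split}_j\circ_2(\text{enddot}_i\circ_1\mathrm{id}_{c_j}\circ_1\text{enddot}_i)$; and merging the two middle strands of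 $c_ic_jc_jc_i$ followed by the six-valent vertex equals: insert $\mathrm{cup}_i$ in the middle, apply two six-valent vertices side by side, apply $\mathrm{cap}_j$ in the middle, merge the two strands $i$. For $i,j$ distant: an enddot, resp. merge, of color $i$ slides through a strand of color $j$. 5. (Parabolic relations) For pairwise distant $i,j,k$ the two ways of crossing $c_ic_jc_k\to c_kc_jc_i$ agree; for $i,j$ adjacent and $k$ distant from both, a strand $k$ slides through the six-valent vertex $c_ic_jc_i\to c_jc_ic_j$; for $i,j$ and $j,k$ adjacent and $i,k$ distant, the two composites of four six-valent vertices and three crossings $$c_ic_jc_kc_ic_jc_i\to c_kc_jc_kc_ic_jc_k$$ given by the two paths $ijkiji\to ijikji\to jijkji\to jikjki\to jkijki\to jkijik\to jkjijk\to kjkijk$ and $ijkiji\to ijkjij\to ikjkij\to kijkij\to kijikj\to kjijkj\to kjikjk\to kjkijk$ agree. **The 2-category.** Let $\mathcal D$ have as objects the natural numbers $n\in\mathbb N_0$, endomorphism category $\mathcal D_n$ for each $n$, with composition of $1$-morphisms given by $\circ_1$, and no $1$-morphisms $m\to n$ for $m\ne n$. Let $\mathcal D^0$ be obtained from $\mathcal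 D$ by adjoining to every hom-category a zero object, all composites with it being zero $1$-morphisms (so for $m\neq n$ the hom-category from $m$ to $n$ has one object, with endomorphism algebra $0$). **Monoidal data.** For $a,b,c\in\mathbb N_0$ let $\mathrm j_{a|c}\colon\mathcal D_b\to\mathcal D_{a+b+c}$ be the color-shifting functor adding $a$ to all colors and all indices of variables. Put $I=0$, $m\otimes n=m+n$, and for $1$- or $2$-morphisms $f$ of $\mathcal D_m$, $g$ of $\mathcal D_n$ put $f\otimes n=\mathrm j_{0|n}(f)$, $m\otimes g=\mathrm j_{m|0}(g)$, so that parabolic induction is $f\boxtimes g=(f\otimes n)\circ_1(m\otimes g)$. For words $f\in\mathcal D_m$, $g\in\mathcal D_n$ let $$\boxtimes_{f,g}\colon(f\otimes n)\circ_1(m\otimes g)\to(m\otimes g)\circ_1(f\otimes n)$$ be the shuffle diagram in which every strand of $f$ crosses every strand of $m\otimes g$ once. On $\mathcal D^0$ use the same data, a zero $1$-morphism tensored with an object being a zero $1$-morphism. **Theorem.** $\mathcal D$ is a locally $\mathbb Z$-graded $\mathbb C$-linear strict $2$-category: its $2$-morphism spaces are graded by the degree of diagrams, and vertical and horizontal composition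 are bilinear and additive in degrees. The data above make $\mathcal D$ a semistrict monoidal $2$-category (Gray monoid) in the sense of Baez–Neuchl, Lemma 4. That is, each $\boxtimes_{f,g}$ is a $2$-isomorphism, and, writing composition of $1$-morphisms as $\circ$ in the usual function order, for objects $A,B$, $1$-morphisms $f\colon A\to A'$, $g\colon B\to B'$, $h$ and $2$-morphisms: - (i) $A\otimes-$ and $-\otimes B$ are strict $2$-functors; - (ii) $x\otimes I=x=I\otimes x$ for every object, $1$-morphism or $2$-morphism $x$; - (iii) $A\otimes(B\otimes x)=(A\otimes B)\otimes x$, $A\otimes(x\otimes B)=(A\otimes x)\otimes B$ and $x\otimes(A\otimes B)=(x\otimes A)\otimes B$ for all such $x$; - (iv) $\boxtimes_{A\otimes g,h}=A\otimes\boxtimes_{g,h}$, $\boxtimes_{f\otimes B,h}=\boxtimes_{f,B\otimes h}$, $\boxtimes_{f,g\otimes C}=\boxtimes_{f,g}\otimes C$; - (v) $\mathrm{id}_A\otimes B=\mathrm{id}_{A\otimes B}=A\otimes\mathrm{id}_B$, $\boxtimes_{\mathrm{id}_A,g}=\mathrm{id}_{A\otimes g}$, $\boxtimes_{f,\mathrm{id}_B}=\mathrm{id}_{f\otimes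 B}$; - (vi), (vii) $\boxtimes_{f,g}\colon(f\otimes B')\circ(A\otimes g)\Rightarrow(A'\otimes g)\circ(f\otimes B)$ is natural with respect to $2$-morphisms $f\Rightarrow f'$ and $g\Rightarrow g'$; - (viii) $\boxtimes_{f'\circ f,g}$ and $\boxtimes_{f,g'\circ g}$ are the evident pastings of $\boxtimes_{f,g}$ with $\boxtimes_{f',g}$, resp. $\boxtimes_{f,g'}$. Moreover $A\otimes-$ and $-\otimes B$ are $\mathbb C$-linear and preserve degrees of $2$-morphisms, and all $\boxtimes_{f,g}$ have degree $0$. The same assertions hold for $\mathcal D^0$. -/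

import Mathlib

open CategoryTheory
open scoped Bicategory

noncomputable section

namespace SoergelDiagrammatics

/-! ## Generating diagrams

Colors and variables are natural numbers: color `i` stands for `c_i`, and `box k` for the box
labelled `x_k`.  A word `[i₁, …, i_k]` in the colors stands for the object
`c_{i₁} ∘₁ ⋯ ∘₁ c_{i_k}`. -/

/-- The colors of `D_n` are `1, …, n - 1`. -/
def IsColor (n i : ℕ) : Prop := 1 ≤ i ∧ i < n

/-- The variables of `D_n` are `x_1, …, x_n`. -/
def IsVar (n k : ℕ) : Prop := 1 ≤ k ∧ k ≤ n

/-- Adjacent colors: `|i - j| = 1`. -/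
def Adjacent (i j : ℕ) : Prop := i + 1 = j ∨ j + 1 = i

/-- Distant colors: `|i - j| > 1`. -/
def Distant (i j : ℕ) : Prop := i + 1 < j ∨ j + 1 < i

/-- The generating morphisms (read from bottom to top). -/
inductive Gen : Type
  | merge (i : ℕ)
  | split (i : ℕ)
  | startdot (i : ℕ)
  | enddot (i : ℕ)
  | six (i j : ℕ)
  | cross (i j : ℕ)
  | box (k : ℕ)

namespace Gen

/-- Source word of a generating morphism. -/
def dom : Gen → List ℕ
  | merge i => [i, i]
  | split i => [i]
  | startdot _ => []
  | enddot i => [i]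
  | six i j => [i, j, i]
  | cross i j => [i, j]
  | box _ => []

/-- Target word of a generating morphism. -/
def cod : Gen → List ℕ
  | merge i => [i]
  | split i => [i, i]
  | startdot i => [i]
  | enddot _ => []
  | six i j => [j, i, j]
  | cross i j => [j, i]
  | box _ => []

/-- Degree of a generating morphism. -/
def deg : Gen → ℤ
  | merge _ => -1
  | split _ => -1
  | startdot _ => 1
  | enddot _ => 1
  | six _ _ => 0
  | cross _ _ => 0
  | box _ => 2

/-- The generating morphisms that are available in `D_n`. -/
def Valid (n : ℕ) : Gen → Prop
  | merge i => IsColor n i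
  | split i => IsColor n i
  | startdot i => IsColor n i
  | enddot i => IsColor n i
  | six i j => IsColor n i ∧ IsColor n j ∧ Adjacent i j
  | cross i j => IsColor n i ∧ IsColor n j ∧ Distant i j
  | box k => IsVar n k

/-- Add `a` to all colors and variable indices. -/
def shift (a : ℕ) : Gen → Gen
  | merge i => merge (a + i)
  | split i => split (a + i)
  | startdot i => startdot (a + i)
  | enddot i => enddot (a + i)
  | six i j => six (a + i) (a + j)
  | cross i j => cross (a + i) (a + j)
  | box k => box (a + k)

end Gen

/-- A horizontal slice of a diagram: one generating morphism with vertical strands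
(colored by two words) to its left and to its right. -/
structure Slice where
  left : List ℕ
  gen : Gen
  right : List ℕ

namespace Slice

/-- Source word of a slice. -/
def dom (s : Slice) : List ℕ := s.left ++ s.gen.dom ++ s.right

/-- Target word of a slice. -/
def cod (s : Slice) : List ℕ := s.left ++ s.gen.cod ++ s.right

end Slice

/-- `IsDiagram n d w w'`: the slices in `d`, stacked from bottom to top, form a diagram in the
generators of `D_n` from the word `w` to the word `w'`. -/
def IsDiagram (n : ℕ) : List Slice → List ℕ → List ℕ → Prop
  | [], w, w' => w = w'
  | s :: d, w, w' => s.gen.Valid n ∧ w = s.dom ∧ IsDiagram n d s.cod w'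

/-- The degree of a diagram. -/
def degree (d : List Slice) : ℤ := (d.map fun s => s.gen.deg).sum

/-- Formal linear combinations of sequences of slices.  The product `x * y` stacks `y` on top of
`x`. -/
abbrev DiagAlg : Type := MonoidAlgebra ℂ (FreeMonoid Slice)

/-- A sequence of slices as an element of `DiagAlg`. -/
def diag (d : List Slice) : DiagAlg := MonoidAlgebra.of ℂ (FreeMonoid Slice) (FreeMonoid.ofList d)

/-- The diagram with the single slice `u · g · v`. -/
def slice (u : List ℕ) (g : Gen) (v : List ℕ) : DiagAlg := diag [⟨u, g, v⟩]

/-- Linear combinations of diagrams of `D_n` from `w` to `w'`. -/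
def linDiag (n : ℕ) (w w' : List ℕ) : Submodule ℂ DiagAlg :=
  Submodule.span ℂ {x | ∃ d : List Slice, IsDiagram n d w w' ∧ x = diag d}

/-- Linear combinations of diagrams of `D_n` of degree `k` from `w` to `w'`. -/
def linDiagDeg (n : ℕ) (w w' : List ℕ) (k : ℤ) : Submodule ℂ DiagAlg :=
  Submodule.span ℂ {x | ∃ d : List Slice, IsDiagram n d w w' ∧ degree d = k ∧ x = diag d}

/-- Place vertical strands `u` to the left and `v` to the right of (every slice of) a diagram. -/
def whisker (u v : List ℕ) : DiagAlg →ₐ[ℂ] DiagAlg :=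
  MonoidAlgebra.mapDomainAlgHom ℂ ℂ
    (FreeMonoid.map fun s : Slice => (⟨u ++ s.left, s.gen, s.right ++ v⟩ : Slice))

/-- Color shifting: add `a` to all colors and to all indices of variables of a diagram. -/
def shift (a : ℕ) : DiagAlg →ₐ[ℂ] DiagAlg :=
  MonoidAlgebra.mapDomainAlgHom ℂ ℂ
    (FreeMonoid.map fun s : Slice =>
      (⟨s.left.map (a + ·), s.gen.shift a, s.right.map (a + ·)⟩ : Slice))

/-! ## The defining relations -/

/-- The cap on color `i`: a merge followed by an enddot. -/
def cap (i : ℕ) : DiagAlg := slice [] (.merge i) [] * slice [] (.enddot i) []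

/-- The cup on color `i`: a startdot followed by a split. -/
def cup (i : ℕ) : DiagAlg := slice [] (.startdot i) [] * slice [] (.split i) []

/-- The product of the boxes `x_k` belonging to a monomial (in increasing order of `k`). -/
def monomialBox (m : ℕ →₀ ℕ) : DiagAlg :=
  ((Finsupp.toMultiset m).sort.map fun k => slice [] (.box k) []).prod

/-- The box decorated by a polynomial. -/
def box : MvPolynomial ℕ ℂ →ₗ[ℂ] DiagAlg :=
  (MvPolynomial.basisMonomials ℕ ℂ).constr ℂ monomialBox

/-- The action of the simple transposition `s_i` on polynomials. -/
def simpleRefl (i : ℕ) : MvPolynomial ℕ ℂ →ₐ[ℂ] MvPolynomial ℕ ℂ :=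
  MvPolynomial.rename (Equiv.swap i (i + 1))

/-- `p` is a polynomial in the variables of `D_n`. -/
def IsPoly (n : ℕ) (p : MvPolynomial ℕ ℂ) : Prop :=
  p ∈ MvPolynomial.supported ℂ {k | IsVar n k}

/-- `q` is the value `∂_i(p) = (p - s_i(p)) / (x_i - x_{i+1})` of the Demazure operator. -/
def IsDemazure (i : ℕ) (p q : MvPolynomial ℕ ℂ) : Prop :=
  (MvPolynomial.X i - MvPolynomial.X (i + 1)) * q = p - simpleRefl i p

/-- The defining relations of `D_n`.  `Basic n w w' r` says that `r`, a linear combination of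
diagrams from `w` to `w'`, is one of the defining relators (left hand side minus right hand
side of a relation). -/
inductive Basic (n : ℕ) : List ℕ → List ℕ → DiagAlg → Prop
  /- Strictly monoidal: diagrams side by side may be moved vertically past each other. -/
  | interchange {w w' v v' : List ℕ} {f g : DiagAlg}
      (hf : f ∈ linDiag n w w') (hg : g ∈ linDiag n v v') :
      Basic n (w ++ v) (w' ++ v')
        (whisker [] v f * whisker w' [] g - whisker w [] g * whisker [] v' f)
  /- Each color is a Frobenius algebra object. -/
  | unit_left {i : ℕ} (hi : IsColor n i) :
      Basic n [i] [i] (slice [] (.startdot i) [i] * slice [] (.merge i) [] - 1)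
  | unit_right {i : ℕ} (hi : IsColor n i) :
      Basic n [i] [i] (slice [i] (.startdot i) [] * slice [] (.merge i) [] - 1)
  | counit_left {i : ℕ} (hi : IsColor n i) :
      Basic n [i] [i] (slice [] (.split i) [] * slice [] (.enddot i) [i] - 1)
  | counit_right {i : ℕ} (hi : IsColor n i) :
      Basic n [i] [i] (slice [] (.split i) [] * slice [i] (.enddot i) [] - 1)
  | assoc {i : ℕ} (hi : IsColor n i) :
      Basic n [i, i, i] [i]
        (slice [] (.merge i) [i] * slice [] (.merge i) []
          - slice [i] (.merge i) [] * slice [] (.merge i) [])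
  | coassoc {i : ℕ} (hi : IsColor n i) :
      Basic n [i] [i, i, i]
        (slice [] (.split i) [] * slice [] (.split i) [i]
          - slice [] (.split i) [] * slice [i] (.split i) [])
  | frobenius_left {i : ℕ} (hi : IsColor n i) :
      Basic n [i, i] [i, i]
        (slice [] (.split i) [i] * slice [i] (.merge i) []
          - slice [] (.merge i) [] * slice [] (.split i) [])
  | frobenius_right {i : ℕ} (hi : IsColor n i) :
      Basic n [i, i] [i, i]
        (slice [i] (.split i) [] * slice [] (.merge i) [i]
          - slice [] (.merge i) [] * slice [] (.split i) [])
  /- Isotopy: rotating a six-valent or four-valent vertex by one strand, in either direction,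
  gives the vertex with the two colors exchanged.  (The snake relations and the rotations of
  dots and trivalent vertices follow from the Frobenius relations.) -/
  | six_rotate_left {i j : ℕ} (hi : IsColor n i) (hj : IsColor n j) (hij : Adjacent i j) :
      Basic n [j, i, j] [i, j, i]
        (whisker [j, i, j] [] (cup i) * slice [j] (.six i j) [i] * whisker [] [i, j, i] (cap j)
          - slice [] (.six j i) [])
  | six_rotate_right {i j : ℕ} (hi : IsColor n i) (hj : IsColor n j) (hij : Adjacent i j) :
      Basic n [j, i, j] [i, j, i]
        (whisker [] [j, i, j] (cup i) * slice [i] (.six i j) [j] * whisker [i, j, i] [] (cap j)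
          - slice [] (.six j i) [])
  | cross_rotate_left {i j : ℕ} (hi : IsColor n i) (hj : IsColor n j) (hij : Distant i j) :
      Basic n [j, i] [i, j]
        (whisker [j, i] [] (cup j) * slice [j] (.cross i j) [j] * whisker [] [i, j] (cap j)
          - slice [] (.cross j i) [])
  | cross_rotate_right {i j : ℕ} (hi : IsColor n i) (hj : IsColor n j) (hij : Distant i j) :
      Basic n [j, i] [i, j]
        (whisker [] [j, i] (cup i) * slice [i] (.cross i j) [i] * whisker [i, j] [] (cap i)
          - slice [] (.cross j i) [])
  /- Polynomial forcing, barbell and needle relations. -/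
  | polyForce {i : ℕ} (hi : IsColor n i) {p q : MvPolynomial ℕ ℂ} (hp : IsPoly n p)
      (hq : IsPoly n q) (hpq : IsDemazure i p q) :
      Basic n [i] [i]
        (whisker [] [i] (box p)
          - (whisker [i] [] (box (simpleRefl i p))
            + slice [] (.enddot i) [] * slice [] (.startdot i) [] * whisker [i] [] (box q)))
  | barbell {i : ℕ} (hi : IsColor n i) :
      Basic n [] []
        (slice [] (.startdot i) [] * slice [] (.enddot i) []
          - box (MvPolynomial.X i - MvPolynomial.X (i + 1)))
  | needle {i : ℕ} (hi : IsColor n i) :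
      Basic n [i] [] (slice [] (.split i) [] * cap i)
  /- Compatibility of the Frobenius structures with six- and four-valent vertices. -/
  | six_enddot {i j : ℕ} (hi : IsColor n i) (hj : IsColor n j) (hij : Adjacent i j) :
      Basic n [i, j, i] [j, j]
        (slice [] (.six i j) [] * slice [j] (.enddot i) [j]
          - (slice [i] (.enddot j) [i] * cap i * cup j
            + slice [] (.enddot i) [j, i] * slice [j] (.enddot i) [] * slice [] (.split j) []))
  | six_merge {i j : ℕ} (hi : IsColor n i) (hj : IsColor n j) (hij : Adjacent i j) :
      Basic n [i, j, j, i] [j, i, j]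
        (slice [i] (.merge j) [i] * slice [] (.six i j) []
          - whisker [i, j] [j, i] (cup i) * slice [] (.six i j) [i, j, i]
            * slice [j, i, j] (.six i j) [] * whisker [j, i] [i, j] (cap j)
            * slice [j] (.merge i) [j])
  | cross_enddot {i j : ℕ} (hi : IsColor n i) (hj : IsColor n j) (hij : Distant i j) :
      Basic n [i, j] [j]
        (slice [] (.cross i j) [] * slice [j] (.enddot i) [] - slice [] (.enddot i) [j])
  | cross_merge {i j : ℕ} (hi : IsColor n i) (hj : IsColor n j) (hij : Distant i j) :
      Basic n [i, i, j] [j, i]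
        (slice [] (.merge i) [j] * slice [] (.cross i j) []
          - slice [i] (.cross i j) [] * slice [] (.cross i j) [i] * slice [j] (.merge i) [])
  /- Parabolic relations of types `A₁ × A₁ × A₁`, `A₁ × A₂` and `A₃`. -/
  | parabolic_A1A1A1 {i j k : ℕ} (hi : IsColor n i) (hj : IsColor n j) (hk : IsColor n k)
      (hij : Distant i j) (hik : Distant i k) (hjk : Distant j k) :
      Basic n [i, j, k] [k, j, i]
        (slice [] (.cross i j) [k] * slice [j] (.cross i k) [] * slice [] (.cross j k) [i]
          - slice [i] (.cross j k) [] * slice [] (.cross i k) [j] * slice [k] (.cross i j) [])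
  | parabolic_A1A2 {i j k : ℕ} (hi : IsColor n i) (hj : IsColor n j) (hk : IsColor n k)
      (hij : Adjacent i j) (hik : Distant i k) (hjk : Distant j k) :
      Basic n [i, j, i, k] [k, j, i, j]
        (slice [] (.six i j) [k] * slice [j, i] (.cross j k) [] * slice [j] (.cross i k) [j]
            * slice [] (.cross j k) [i, j]
          - slice [i, j] (.cross i k) [] * slice [i] (.cross j k) [i]
            * slice [] (.cross i k) [j, i] * slice [k] (.six i j) [])
  | parabolic_A3 {i j k : ℕ} (hi : IsColor n i) (hj : IsColor n j) (hk : IsColor n k)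
      (hij : Adjacent i j) (hjk : Adjacent j k) (hik : Distant i k) :
      Basic n [i, j, k, i, j, i] [k, j, k, i, j, k]
        (slice [i, j] (.cross k i) [j, i] * slice [] (.six i j) [k, j, i]
            * slice [j, i] (.six j k) [i] * slice [j] (.cross i k) [j, k, i]
            * slice [j, k, i, j] (.cross k i) [] * slice [j, k] (.six i j) [k]
            * slice [] (.six j k) [i, j, k]
          - slice [i, j, k] (.six i j) [] * slice [i] (.six j k) [i, j]
            * slice [] (.cross i k) [j, k, i, j] * slice [k, i, j] (.cross k i) [j]
            * slice [k] (.six i j) [k, j] * slice [k, j, i] (.six j k) []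
            * slice [k, j] (.cross i k) [j, k])

/-- The tensor ideal generated by the defining relations. -/
inductive InIdeal (n : ℕ) : List ℕ → List ℕ → DiagAlg → Prop
  | basic {w w' : List ℕ} {r : DiagAlg} (h : Basic n w w' r) : InIdeal n w w' r
  | zero (w w' : List ℕ) : InIdeal n w w' 0
  | add {w w' : List ℕ} {r s : DiagAlg} (hr : InIdeal n w w' r) (hs : InIdeal n w w' s) :
      InIdeal n w w' (r + s)
  | smul {w w' : List ℕ} (c : ℂ) {r : DiagAlg} (hr : InIdeal n w w' r) : InIdeal n w w' (c • r)
  | comp_left {v w w' : List ℕ} {p r : DiagAlg} (hp : p ∈ linDiag n v w)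
      (hr : InIdeal n w w' r) : InIdeal n v w' (p * r)
  | comp_right {w w' v : List ℕ} {r p : DiagAlg} (hr : InIdeal n w w' r)
      (hp : p ∈ linDiag n w' v) : InIdeal n w v (r * p)
  | whisker (u v : List ℕ) {w w' : List ℕ} {r : DiagAlg} (hr : InIdeal n w w' r) :
      InIdeal n (u ++ w ++ v) (u ++ w' ++ v) (whisker u v r)

/-- The tensor ideal as a family of subspaces. -/
def ideal (n : ℕ) (w w' : List ℕ) : Submodule ℂ DiagAlg where
  carrier := {r | InIdeal n w w' r}
  zero_mem' := .zero w w'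
  add_mem' := .add
  smul_mem' c _ h := .smul c h

/-- The morphism space from `w` to `w'` in `D_n`. -/
abbrev HomSpace (n : ℕ) (w w' : List ℕ) : Type :=
  ↥(linDiag n w w') ⧸ (ideal n w w').comap (linDiag n w w').subtype

/-! ## Basic facts on diagrams -/

lemma diag_append (d d' : List Slice) : diag (d ++ d') = diag d * diag d' := by
  simp [diag]

lemma diag_nil : diag [] = 1 := by
  simp [diag, MonoidAlgebra.one_def]

lemma whisker_diag (u v : List ℕ) (d : List Slice) :
    whisker u v (diag d) = diag (d.map fun s => ⟨u ++ s.left, s.gen, s.right ++ v⟩) := by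
  simp [whisker, diag, ← FreeMonoid.ofList_map]

lemma shift_diag (a : ℕ) (d : List Slice) :
    shift a (diag d) =
      diag (d.map fun s => ⟨s.left.map (a + ·), s.gen.shift a, s.right.map (a + ·)⟩) := by
  simp [shift, diag, ← FreeMonoid.ofList_map]

lemma isDiagram_append {n : ℕ} {d d' : List Slice} {u v w : List ℕ} (h : IsDiagram n d u v)
    (h' : IsDiagram n d' v w) : IsDiagram n (d ++ d') u w := by
  induction d generalizing u with
  | nil => cases h; exact h'
  | cons s d ih => exact ⟨h.1, h.2.1, ih h.2.2⟩

lemma isDiagram_whisker {n : ℕ} (u v : List ℕ) {d : List Slice} {w w' : List ℕ}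
    (h : IsDiagram n d w w') :
    IsDiagram n (d.map fun s => ⟨u ++ s.left, s.gen, s.right ++ v⟩) (u ++ w ++ v)
      (u ++ w' ++ v) := by
  induction d generalizing w with
  | nil => cases h; rfl
  | cons s d ih =>
    refine ⟨h.1, by simp [h.2.1, Slice.dom], ?_⟩
    have := ih h.2.2
    simpa [Slice.cod] using this

lemma Gen.shift_valid {a n N : ℕ} (hN : a + n ≤ N) {g : Gen} (h : g.Valid n) :
    (g.shift a).Valid N := by
  cases g <;> simp only [Gen.shift, Gen.Valid, IsColor, IsVar, Adjacent, Distant] at h ⊢ <;> omega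

lemma Gen.shift_dom (a : ℕ) (g : Gen) : (g.shift a).dom = g.dom.map (a + ·) := by
  cases g <;> rfl

lemma Gen.shift_cod (a : ℕ) (g : Gen) : (g.shift a).cod = g.cod.map (a + ·) := by
  cases g <;> rfl

lemma isDiagram_shift {a n N : ℕ} (hN : a + n ≤ N) {d : List Slice} {w w' : List ℕ}
    (h : IsDiagram n d w w') :
    IsDiagram N (d.map fun s => ⟨s.left.map (a + ·), s.gen.shift a, s.right.map (a + ·)⟩)
      (w.map (a + ·)) (w'.map (a + ·)) := by
  induction d generalizing w with
  | nil => cases h; rfl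
  | cons s d ih =>
    refine ⟨Gen.shift_valid hN h.1, by simp [h.2.1, Slice.dom, Gen.shift_dom], ?_⟩
    have := ih h.2.2
    simpa [Slice.cod, Gen.shift_cod] using this

lemma one_mem_linDiag (n : ℕ) {w w' : List ℕ} (h : w = w') : 1 ∈ linDiag n w w' :=
  Submodule.subset_span ⟨[], h, diag_nil.symm⟩

lemma slice_mem_linDiag {n : ℕ} {g : Gen} (hg : g.Valid n) (u v : List ℕ) {w w' : List ℕ}
    (hw : w = u ++ g.dom ++ v) (hw' : w' = u ++ g.cod ++ v) : slice u g v ∈ linDiag n w w' :=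
  Submodule.subset_span ⟨[⟨u, g, v⟩], ⟨hg, hw, hw'.symm⟩, rfl⟩

lemma mul_mem_linDiag {n : ℕ} {u v w : List ℕ} {x y : DiagAlg} (hx : x ∈ linDiag n u v)
    (hy : y ∈ linDiag n v w) : x * y ∈ linDiag n u w := by
  have h := Submodule.mul_mem_mul hx hy
  rw [linDiag, linDiag, Submodule.span_mul_span] at h
  refine Submodule.span_mono ?_ h
  rintro _ ⟨_, ⟨d, hd, rfl⟩, _, ⟨d', hd', rfl⟩, rfl⟩
  exact ⟨d ++ d', isDiagram_append hd hd', (diag_append d d').symm⟩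

lemma whisker_mem_linDiag {n : ℕ} (u v : List ℕ) {w w' : List ℕ} {x : DiagAlg}
    (hx : x ∈ linDiag n w w') : whisker u v x ∈ linDiag n (u ++ w ++ v) (u ++ w' ++ v) := by
  have h := Submodule.mem_map_of_mem (f := (whisker u v).toLinearMap) hx
  rw [linDiag, Submodule.map_span] at h
  refine Submodule.span_mono ?_ h
  rintro _ ⟨_, ⟨d, hd, rfl⟩, rfl⟩
  exact ⟨_, isDiagram_whisker u v hd, whisker_diag u v d⟩

lemma shift_mem_linDiag {a n N : ℕ} (hN : a + n ≤ N) {w w' : List ℕ} {x : DiagAlg}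
    (hx : x ∈ linDiag n w w') :
    shift a x ∈ linDiag N (w.map (a + ·)) (w'.map (a + ·)) := by
  have h := Submodule.mem_map_of_mem (f := (shift a).toLinearMap) hx
  rw [linDiag, Submodule.map_span] at h
  refine Submodule.span_mono ?_ h
  rintro _ ⟨_, ⟨d, hd, rfl⟩, rfl⟩
  exact ⟨_, isDiagram_shift hN hd, shift_diag a d⟩

lemma diagAlg_hom_ext {φ ψ : DiagAlg →ₐ[ℂ] DiagAlg} (h : ∀ d, φ (diag d) = ψ (diag d))
    (x : DiagAlg) : φ x = ψ x := by
  have : φ = ψ := by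
    exact MonoidAlgebra.algHom_ext (fun d => h (FreeMonoid.toList d)) (Subsingleton.elim _ _)
  rw [this]

lemma whisker_whisker (u v u' v' : List ℕ) (x : DiagAlg) :
    whisker u v (whisker u' v' x) = whisker (u ++ u') (v' ++ v) x := by
  refine diagAlg_hom_ext (φ := (whisker u v).comp (whisker u' v')) (fun d => ?_) x
  simp [whisker_diag, Function.comp_def]

lemma whisker_nil_nil (x : DiagAlg) : whisker [] [] x = x := by
  refine diagAlg_hom_ext (ψ := AlgHom.id ℂ DiagAlg) (fun d => ?_) x
  simp [whisker_diag]

lemma shift_whisker (a : ℕ) (u v : List ℕ) (x : DiagAlg) :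
    shift a (whisker u v x) = whisker (u.map (a + ·)) (v.map (a + ·)) (shift a x) := by
  refine diagAlg_hom_ext (φ := (shift a).comp (whisker u v))
    (ψ := (whisker (u.map (a + ·)) (v.map (a + ·))).comp (shift a)) (fun d => ?_) x
  simp [whisker_diag, shift_diag, Function.comp_def]

lemma shift_slice (a : ℕ) (u : List ℕ) (g : Gen) (v : List ℕ) :
    shift a (slice u g v) = slice (u.map (a + ·)) (g.shift a) (v.map (a + ·)) := by
  simp [slice, shift_diag]

lemma shift_cap (a i : ℕ) : shift a (cap i) = cap (a + i) := by
  simp [cap, shift_slice, Gen.shift]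

lemma shift_cup (a i : ℕ) : shift a (cup i) = cup (a + i) := by
  simp [cup, shift_slice, Gen.shift]

lemma shift_box (a : ℕ) (p : MvPolynomial ℕ ℂ) :
    shift a (box p) = box (MvPolynomial.rename (a + ·) p) := by
  have h : (shift a).toLinearMap ∘ₗ box =
      box ∘ₗ (MvPolynomial.rename (R := ℂ) (a + · : ℕ → ℕ)).toLinearMap := by
    refine (MvPolynomial.basisMonomials ℕ ℂ).ext fun m => ?_
    have e : MvPolynomial.rename (a + ·) (MvPolynomial.basisMonomials ℕ ℂ m) =
        MvPolynomial.basisMonomials ℕ ℂ (m.mapDomain (a + ·)) := by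
      simp [MvPolynomial.rename_monomial]
    simp only [LinearMap.comp_apply, AlgHom.toLinearMap_apply, e]
    rw [box, Module.Basis.constr_basis, Module.Basis.constr_basis, monomialBox, monomialBox,
      map_list_prod, List.map_map, ← Finsupp.toMultiset_map,
      ← Multiset.map_sort (r := (· ≤ ·)) (f := (a + ·)) (hs := by intros; simp), List.map_map]
    congr 1
    refine List.map_congr_left fun k _ => ?_
    simp [shift_slice, Gen.shift]
  exact LinearMap.congr_fun h p

lemma rename_simpleRefl (a i : ℕ) (p : MvPolynomial ℕ ℂ) :
    MvPolynomial.rename (a + ·) (simpleRefl i p) =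
      simpleRefl (a + i) (MvPolynomial.rename (a + ·) p) := by
  simp only [simpleRefl, MvPolynomial.rename_rename]
  congr 2
  funext k
  simp only [Function.comp_apply, Equiv.swap_apply_def]
  split_ifs <;> omega

lemma isPoly_rename {a n N : ℕ} (hN : a + n ≤ N) {p : MvPolynomial ℕ ℂ} (hp : IsPoly n p) :
    IsPoly N (MvPolynomial.rename (a + ·) p) := by
  rw [IsPoly, MvPolynomial.mem_supported] at *
  intro k hk
  obtain ⟨l, hl, rfl⟩ := Finset.mem_image.1 (MvPolynomial.vars_rename (a + ·) p hk)
  have : IsVar n l := hp hl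
  simp only [IsVar, Set.mem_ofPred_eq] at *
  omega

lemma isDemazure_rename (a : ℕ) {i : ℕ} {p q : MvPolynomial ℕ ℂ} (h : IsDemazure i p q) :
    IsDemazure (a + i) (MvPolynomial.rename (a + ·) p) (MvPolynomial.rename (a + ·) q) := by
  have := congrArg (MvPolynomial.rename (a + ·)) h
  simpa [IsDemazure, rename_simpleRefl, add_assoc] using this

lemma IsColor.shift {a n N i : ℕ} (hN : a + n ≤ N) (h : IsColor n i) : IsColor N (a + i) := by
  simp only [IsColor] at *; omega

lemma Adjacent.shift (a : ℕ) {i j : ℕ} (h : Adjacent i j) : Adjacent (a + i) (a + j) := by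
  simp only [Adjacent] at *; omega

lemma Distant.shift (a : ℕ) {i j : ℕ} (h : Distant i j) : Distant (a + i) (a + j) := by
  simp only [Distant] at *; omega

lemma Basic.shift {a n N : ℕ} (hN : a + n ≤ N) {w w' : List ℕ} {r : DiagAlg}
    (h : Basic n w w' r) :
    Basic N (w.map (a + ·)) (w'.map (a + ·)) (SoergelDiagrammatics.shift a r) := by
  cases h with
  | interchange hf hg =>
    simpa [shift_whisker] using
      Basic.interchange (shift_mem_linDiag hN hf) (shift_mem_linDiag hN hg)
  | polyForce hi hp hq hpq =>
    simpa [shift_slice, shift_whisker, shift_box, Gen.shift, rename_simpleRefl] using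
      Basic.polyForce (hi.shift hN) (isPoly_rename hN hp) (isPoly_rename hN hq)
        (isDemazure_rename a hpq)
  | barbell hi =>
    simpa [shift_slice, shift_box, Gen.shift, add_assoc] using Basic.barbell (hi.shift hN)
  | unit_left hi =>
    simpa [shift_slice, Gen.shift] using Basic.unit_left (hi.shift hN)
  | unit_right hi =>
    simpa [shift_slice, Gen.shift] using Basic.unit_right (hi.shift hN)
  | counit_left hi =>
    simpa [shift_slice, Gen.shift] using Basic.counit_left (hi.shift hN)
  | counit_right hi =>
    simpa [shift_slice, Gen.shift] using Basic.counit_right (hi.shift hN)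
  | assoc hi =>
    simpa [shift_slice, Gen.shift] using Basic.assoc (hi.shift hN)
  | coassoc hi =>
    simpa [shift_slice, Gen.shift] using Basic.coassoc (hi.shift hN)
  | frobenius_left hi =>
    simpa [shift_slice, Gen.shift] using Basic.frobenius_left (hi.shift hN)
  | frobenius_right hi =>
    simpa [shift_slice, Gen.shift] using Basic.frobenius_right (hi.shift hN)
  | needle hi =>
    simpa [shift_slice, shift_cap, Gen.shift] using Basic.needle (hi.shift hN)
  | six_rotate_left hi hj hij =>
    simpa [shift_slice, shift_whisker, shift_cap, shift_cup, Gen.shift] using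
      Basic.six_rotate_left (hi.shift hN) (hj.shift hN) (hij.shift a)
  | six_rotate_right hi hj hij =>
    simpa [shift_slice, shift_whisker, shift_cap, shift_cup, Gen.shift] using
      Basic.six_rotate_right (hi.shift hN) (hj.shift hN) (hij.shift a)
  | cross_rotate_left hi hj hij =>
    simpa [shift_slice, shift_whisker, shift_cap, shift_cup, Gen.shift] using
      Basic.cross_rotate_left (hi.shift hN) (hj.shift hN) (hij.shift a)
  | cross_rotate_right hi hj hij =>
    simpa [shift_slice, shift_whisker, shift_cap, shift_cup, Gen.shift] using
      Basic.cross_rotate_right (hi.shift hN) (hj.shift hN) (hij.shift a)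
  | six_enddot hi hj hij =>
    simpa [shift_slice, shift_cap, shift_cup, Gen.shift] using
      Basic.six_enddot (hi.shift hN) (hj.shift hN) (hij.shift a)
  | six_merge hi hj hij =>
    simpa [shift_slice, shift_whisker, shift_cap, shift_cup, Gen.shift] using
      Basic.six_merge (hi.shift hN) (hj.shift hN) (hij.shift a)
  | cross_enddot hi hj hij =>
    simpa [shift_slice, Gen.shift] using
      Basic.cross_enddot (hi.shift hN) (hj.shift hN) (hij.shift a)
  | cross_merge hi hj hij =>
    simpa [shift_slice, Gen.shift] using
      Basic.cross_merge (hi.shift hN) (hj.shift hN) (hij.shift a)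
  | parabolic_A1A1A1 hi hj hk hij hik hjk =>
    simpa [shift_slice, Gen.shift] using
      Basic.parabolic_A1A1A1 (hi.shift hN) (hj.shift hN) (hk.shift hN) (hij.shift a)
        (hik.shift a) (hjk.shift a)
  | parabolic_A1A2 hi hj hk hij hik hjk =>
    simpa [shift_slice, Gen.shift] using
      Basic.parabolic_A1A2 (hi.shift hN) (hj.shift hN) (hk.shift hN) (hij.shift a)
        (hik.shift a) (hjk.shift a)
  | parabolic_A3 hi hj hk hij hjk hik =>
    simpa [shift_slice, Gen.shift] using
      Basic.parabolic_A3 (hi.shift hN) (hj.shift hN) (hk.shift hN) (hij.shift a)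
        (hjk.shift a) (hik.shift a)

lemma InIdeal.shift {a n N : ℕ} (hN : a + n ≤ N) {w w' : List ℕ} {r : DiagAlg}
    (h : InIdeal n w w' r) :
    InIdeal N (w.map (a + ·)) (w'.map (a + ·)) (SoergelDiagrammatics.shift a r) := by
  induction h with
  | basic h => exact .basic (h.shift hN)
  | zero => simpa using InIdeal.zero _ _
  | add _ _ ih ih' => simpa using ih.add ih'
  | smul c _ ih => simpa using ih.smul c
  | comp_left hp _ ih => simpa using InIdeal.comp_left (shift_mem_linDiag hN hp) ih
  | comp_right _ hp ih => simpa using ih.comp_right (shift_mem_linDiag hN hp)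
  | whisker u v _ ih =>
    simpa [shift_whisker] using ih.whisker (u.map (a + ·)) (v.map (a + ·))

/-! ## Operations on the morphism spaces of `D_n` -/

namespace HomSpace

/-- The class of a linear combination of diagrams. -/
def mk {n : ℕ} {w w' : List ℕ} (x : DiagAlg) (hx : x ∈ linDiag n w w') : HomSpace n w w' :=
  Submodule.Quotient.mk ⟨x, hx⟩

lemma ind {n : ℕ} {w w' : List ℕ} {P : HomSpace n w w' → Prop}
    (h : ∀ x hx, P (mk x hx)) (α : HomSpace n w w') : P α := by
  obtain ⟨⟨x, hx⟩, rfl⟩ := Submodule.Quotient.mk_surjective _ α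
  exact h x hx

lemma mk_eq_mk {n : ℕ} {w w' : List ℕ} {x y : DiagAlg} {hx : x ∈ linDiag n w w'}
    {hy : y ∈ linDiag n w w'} : mk x hx = mk y hy ↔ InIdeal n w w' (x - y) :=
  Submodule.Quotient.eq _

lemma mk_congr {n : ℕ} {w w' : List ℕ} {x y : DiagAlg} {hx : x ∈ linDiag n w w'}
    {hy : y ∈ linDiag n w w'} (h : x = y) : mk x hx = mk y hy := by
  subst h; rfl

lemma mk_add {n : ℕ} {w w' : List ℕ} {x y : DiagAlg} (hx : x ∈ linDiag n w w')
    (hy : y ∈ linDiag n w w') : mk x hx + mk y hy = mk (x + y) (add_mem hx hy) := rfl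

lemma smul_mk {n : ℕ} {w w' : List ℕ} (c : ℂ) {x : DiagAlg} (hx : x ∈ linDiag n w w') :
    c • mk x hx = mk (c • x) (Submodule.smul_mem _ c hx) := rfl

/-- Vertical composition (stacking the second diagram on top of the first). -/
def comp {n : ℕ} {u v w : List ℕ} (α : HomSpace n u v) (β : HomSpace n v w) : HomSpace n u w :=
  Quotient.map₂ (fun x y => (⟨x.1 * y.1, mul_mem_linDiag x.2 y.2⟩ : linDiag n u w))
    (by
      intro x x' hx y y' hy
      have hx : InIdeal n u v (x.1 - x'.1) := (Submodule.quotientRel_def _).1 hx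
      have hy : InIdeal n v w (y.1 - y'.1) := (Submodule.quotientRel_def _).1 hy
      refine (Submodule.quotientRel_def _).2 ?_
      show InIdeal n u w (x.1 * y.1 - x'.1 * y'.1)
      have := (hx.comp_right y.2).add (hy.comp_left x'.2)
      rwa [sub_mul, mul_sub, sub_add_sub_cancel] at this) α β

lemma mk_comp_mk {n : ℕ} {u v w : List ℕ} {x y : DiagAlg} (hx : x ∈ linDiag n u v)
    (hy : y ∈ linDiag n v w) : (mk x hx).comp (mk y hy) = mk (x * y) (mul_mem_linDiag hx hy) :=
  rfl

/-- The identity diagram, from a word to an equal word. -/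
def ofEq (n : ℕ) {w w' : List ℕ} (h : w = w') : HomSpace n w w' := mk 1 (one_mem_linDiag n h)

/-- Place strands to the left. -/
def whiskerLeft {n : ℕ} (u : List ℕ) {w w' : List ℕ} :
    HomSpace n w w' →ₗ[ℂ] HomSpace n (u ++ w) (u ++ w') :=
  Submodule.mapQ _ _
    ((whisker u []).toLinearMap.restrict fun _ hx => by simpa using whisker_mem_linDiag u [] hx)
    (by
      intro x hx
      have h : InIdeal n (u ++ w ++ []) (u ++ w' ++ []) (whisker u [] x.1) :=
        InIdeal.whisker u [] hx
      rw [List.append_nil, List.append_nil] at h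
      exact h)

/-- Place strands to the right.  (The rank is allowed to change along an equality.) -/
def whiskerRight {n N : ℕ} (hN : n = N) {w w' : List ℕ} (v : List ℕ) :
    HomSpace n w w' →ₗ[ℂ] HomSpace N (w ++ v) (w' ++ v) :=
  Submodule.mapQ _ _
    ((whisker [] v).toLinearMap.restrict fun _ hx => hN ▸ whisker_mem_linDiag [] v hx)
    (by
      subst hN
      intro _ hx
      exact InIdeal.whisker [] v hx)

/-- The color-shifting functor `D_n → D_N` (adding `a` to colors and variables) on morphisms. -/
def shift {n : ℕ} (a N : ℕ) (hN : a + n ≤ N) {w w' : List ℕ} :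
    HomSpace n w w' →ₗ[ℂ] HomSpace N (w.map (a + ·)) (w'.map (a + ·)) :=
  Submodule.mapQ _ _
    ((SoergelDiagrammatics.shift a).toLinearMap.restrict fun _ hx => shift_mem_linDiag hN hx)
    (fun _ hx => InIdeal.shift hN hx)

lemma whiskerLeft_mk {n : ℕ} (u : List ℕ) {w w' : List ℕ} {x : DiagAlg}
    (hx : x ∈ linDiag n w w') :
    whiskerLeft u (mk x hx) =
      mk (whisker u [] x) (by simpa using whisker_mem_linDiag u [] hx) := rfl

lemma whiskerRight_mk {n N : ℕ} (hN : n = N) (v : List ℕ) {w w' : List ℕ} {x : DiagAlg}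
    (hx : x ∈ linDiag n w w') :
    whiskerRight hN v (mk x hx) = mk (whisker [] v x) (hN ▸ whisker_mem_linDiag [] v hx) := rfl

/-- The subspace of morphisms of degree `k`. -/
def piece {n : ℕ} (w w' : List ℕ) (k : ℤ) : Submodule ℂ (HomSpace n w w') :=
  ((linDiagDeg n w w' k).comap (linDiag n w w').subtype).map (Submodule.mkQ _)

end HomSpace

/-! ## Locally graded linear 2-categories and semistrict monoidal structures -/

universe w v u

/-- A strict 2-functor between (strict) 2-categories: functorial on 1-morphisms and on
2-morphisms, compatible with whiskering (hence with horizontal composition). -/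
structure IsTwoFunctor {C D : Type*} [Bicategory C] [Bicategory D] (F₀ : C → D)
    (F₁ : ∀ {a b : C}, (a ⟶ b) → (F₀ a ⟶ F₀ b))
    (F₂ : ∀ {a b : C} {f g : a ⟶ b}, (f ⟶ g) → (F₁ f ⟶ F₁ g)) : Prop where
  map₁_id (a : C) : F₁ (𝟙 a) = 𝟙 (F₀ a)
  map₁_comp {a b c : C} (f : a ⟶ b) (g : b ⟶ c) : F₁ (f ≫ g) = F₁ f ≫ F₁ g
  map₂_id {a b : C} (f : a ⟶ b) : F₂ (𝟙 f) = 𝟙 (F₁ f)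
  map₂_comp {a b : C} {f g h : a ⟶ b} (η : f ⟶ g) (θ : g ⟶ h) : F₂ (η ≫ θ) = F₂ η ≫ F₂ θ
  map₂_whiskerLeft {a b c : C} (f : a ⟶ b) {g h : b ⟶ c} (η : g ⟶ h) :
    HEq (F₂ (f ◁ η)) (F₁ f ◁ F₂ η)
  map₂_whiskerRight {a b c : C} {f g : a ⟶ b} (η : f ⟶ g) (h : b ⟶ c) :
    HEq (F₂ (η ▷ h)) (F₂ η ▷ F₁ h)

/-- A family of `ℤ`-indexed subspaces of the spaces of 2-morphisms. -/
structure Grading (C : Type u) [Bicategory.{w, v} C] [∀ a b : C, Preadditive (a ⟶ b)]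
    [∀ a b : C, Linear ℂ (a ⟶ b)] where
  piece : ∀ {a b : C} (f g : a ⟶ b), ℤ → Submodule ℂ (f ⟶ g)

/-- The 2-category `C` is locally graded `ℂ`-linear: the spaces of 2-morphisms are graded vector
spaces, vertical composition (bilinear by `Linear`) and whiskering are linear and respect
degrees. -/
structure Grading.IsLocallyGradedLinear {C : Type u} [Bicategory.{w, v} C]
    [∀ a b : C, Preadditive (a ⟶ b)] [∀ a b : C, Linear ℂ (a ⟶ b)] (G : Grading C) : Prop where
  isInternal {a b : C} (f g : a ⟶ b) : DirectSum.IsInternal (G.piece f g)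
  id_mem {a b : C} (f : a ⟶ b) : 𝟙 f ∈ G.piece f f 0
  comp_mem {a b : C} {f g h : a ⟶ b} {k l : ℤ} {η : f ⟶ g} {θ : g ⟶ h}
    (hη : η ∈ G.piece f g k) (hθ : θ ∈ G.piece g h l) : η ≫ θ ∈ G.piece f h (k + l)
  whiskerLeft_mem {a b c : C} (f : a ⟶ b) {g h : b ⟶ c} {k : ℤ} {η : g ⟶ h}
    (hη : η ∈ G.piece g h k) : f ◁ η ∈ G.piece (f ≫ g) (f ≫ h) k
  whiskerRight_mem {a b c : C} {f g : a ⟶ b} {k : ℤ} {η : f ⟶ g} (hη : η ∈ G.piece f g k)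
    (h : b ⟶ c) : η ▷ h ∈ G.piece (f ≫ h) (g ≫ h) k
  whiskerLeft_add {a b c : C} (f : a ⟶ b) {g h : b ⟶ c} (η θ : g ⟶ h) :
    f ◁ (η + θ) = f ◁ η + f ◁ θ
  whiskerLeft_smul {a b c : C} (f : a ⟶ b) {g h : b ⟶ c} (r : ℂ) (η : g ⟶ h) :
    f ◁ (r • η) = r • f ◁ η
  add_whiskerRight {a b c : C} {f g : a ⟶ b} (η θ : f ⟶ g) (h : b ⟶ c) :
    (η + θ) ▷ h = η ▷ h + θ ▷ h
  smul_whiskerRight {a b c : C} {f g : a ⟶ b} (r : ℂ) (η : f ⟶ g) (h : b ⟶ c) :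
    (r • η) ▷ h = r • η ▷ h

/-- The data of a semistrict monoidal structure (Gray monoid) on a 2-category. -/
structure TensorData (C : Type u) [Bicategory.{w, v} C] where
  /-- The unit object. -/
  unit : C
  /-- `A ⊗ B` -/
  obj : C → C → C
  /-- `f ⊗ B` for a 1-morphism `f` -/
  right₁ : ∀ {A A' : C} (_ : A ⟶ A') (B : C), obj A B ⟶ obj A' B
  /-- `A ⊗ g` for a 1-morphism `g` -/
  left₁ : ∀ (A : C) {B B' : C} (_ : B ⟶ B'), obj A B ⟶ obj A B'
  /-- `α ⊗ B` for a 2-morphism `α` -/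
  right₂ : ∀ {A A' : C} {f f' : A ⟶ A'} (_ : f ⟶ f') (B : C), right₁ f B ⟶ right₁ f' B
  /-- `A ⊗ β` for a 2-morphism `β` -/
  left₂ : ∀ (A : C) {B B' : C} {g g' : B ⟶ B'} (_ : g ⟶ g'), left₁ A g ⟶ left₁ A g'
  /-- The tensorator `(f ⊗ B') ∘ (A ⊗ g) ⟶ (A' ⊗ g) ∘ (f ⊗ B)` -/
  tensorator : ∀ {A A' B B' : C} (f : A ⟶ A') (g : B ⟶ B'),
    left₁ A g ≫ right₁ f B' ⟶ right₁ f B ≫ left₁ A' g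

/-- The axioms of a semistrict monoidal 2-category, as listed by Baez and Neuchl.  (Equalities
between 2-morphisms whose sources and targets are only propositionally equal are expressed by
`HEq`.) -/
structure TensorData.IsSemistrictMonoidal {C : Type u} [Bicategory.{w, v} C]
    (T : TensorData C) : Prop where
  /- (7): the tensorators are 2-isomorphisms. -/
  isIso_tensorator {A A' B B' : C} (f : A ⟶ A') (g : B ⟶ B') : IsIso (T.tensorator f g)
  /- (i): `A ⊗ -` and `- ⊗ B` are 2-functors. -/
  left_twoFunctor (A : C) : IsTwoFunctor (T.obj A) (T.left₁ A) (T.left₂ A)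
  right_twoFunctor (B : C) :
    IsTwoFunctor (T.obj · B) (fun f => T.right₁ f B) (fun α => T.right₂ α B)
  /- (ii): `x ⊗ I = I ⊗ x = x`. -/
  obj_unit (A : C) : T.obj A T.unit = A
  unit_obj (A : C) : T.obj T.unit A = A
  right₁_unit {A A' : C} (f : A ⟶ A') : HEq (T.right₁ f T.unit) f
  unit_left₁ {A A' : C} (f : A ⟶ A') : HEq (T.left₁ T.unit f) f
  right₂_unit {A A' : C} {f f' : A ⟶ A'} (α : f ⟶ f') : HEq (T.right₂ α T.unit) α
  unit_left₂ {A A' : C} {f f' : A ⟶ A'} (α : f ⟶ f') : HEq (T.left₂ T.unit α) α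
  /- (iii): `A ⊗ (B ⊗ x) = (A ⊗ B) ⊗ x`, `A ⊗ (x ⊗ B) = (A ⊗ x) ⊗ B`,
  `x ⊗ (A ⊗ B) = (x ⊗ A) ⊗ B`. -/
  obj_assoc (A B X : C) : T.obj A (T.obj B X) = T.obj (T.obj A B) X
  left₁_left₁ (A B : C) {X X' : C} (f : X ⟶ X') :
    HEq (T.left₁ A (T.left₁ B f)) (T.left₁ (T.obj A B) f)
  left₁_right₁ (A : C) {X X' : C} (f : X ⟶ X') (B : C) :
    HEq (T.left₁ A (T.right₁ f B)) (T.right₁ (T.left₁ A f) B)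
  right₁_right₁ {X X' : C} (f : X ⟶ X') (A B : C) :
    HEq (T.right₁ f (T.obj A B)) (T.right₁ (T.right₁ f A) B)
  left₂_left₂ (A B : C) {X X' : C} {f f' : X ⟶ X'} (α : f ⟶ f') :
    HEq (T.left₂ A (T.left₂ B α)) (T.left₂ (T.obj A B) α)
  left₂_right₂ (A : C) {X X' : C} {f f' : X ⟶ X'} (α : f ⟶ f') (B : C) :
    HEq (T.left₂ A (T.right₂ α B)) (T.right₂ (T.left₂ A α) B)
  right₂_right₂ {X X' : C} {f f' : X ⟶ X'} (α : f ⟶ f') (A B : C) :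
    HEq (T.right₂ α (T.obj A B)) (T.right₂ (T.right₂ α A) B)
  /- (iv): tensoring the tensorator with an object. -/
  tensorator_left (A : C) {B B' X X' : C} (g : B ⟶ B') (h : X ⟶ X') :
    HEq (T.tensorator (T.left₁ A g) h) (T.left₂ A (T.tensorator g h))
  tensorator_middle {A A' : C} (f : A ⟶ A') (B : C) {X X' : C} (h : X ⟶ X') :
    HEq (T.tensorator (T.right₁ f B) h) (T.tensorator f (T.left₁ B h))
  tensorator_right {A A' B B' : C} (f : A ⟶ A') (g : B ⟶ B') (X : C) :
    HEq (T.tensorator f (T.right₁ g X)) (T.right₂ (T.tensorator f g) X)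
  /- (v): identities. -/
  right₁_id (A B : C) : T.right₁ (𝟙 A) B = 𝟙 (T.obj A B)
  left₁_id (A B : C) : T.left₁ A (𝟙 B) = 𝟙 (T.obj A B)
  tensorator_id_left (A : C) {B B' : C} (g : B ⟶ B') :
    HEq (T.tensorator (𝟙 A) g) (𝟙 (T.left₁ A g))
  tensorator_id_right {A A' : C} (f : A ⟶ A') (B : C) :
    HEq (T.tensorator f (𝟙 B)) (𝟙 (T.right₁ f B))
  /- (vi): naturality in the first argument. -/
  tensorator_naturality_left {A A' B B' : C} {f f' : A ⟶ A'} (α : f ⟶ f') (g : B ⟶ B') :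
    T.tensorator f g ≫ T.right₂ α B ▷ T.left₁ A' g =
      T.left₁ A g ◁ T.right₂ α B' ≫ T.tensorator f' g
  /- (vii): naturality in the second argument. -/
  tensorator_naturality_right {A A' B B' : C} (f : A ⟶ A') {g g' : B ⟶ B'} (β : g ⟶ g') :
    T.tensorator f g ≫ T.right₁ f B ◁ T.left₂ A' β =
      T.left₂ A β ▷ T.right₁ f B' ≫ T.tensorator f g'
  /- (viii): compatibility with composition of 1-morphisms. -/
  tensorator_comp_left {A A' A'' B B' : C} (f : A ⟶ A') (f' : A' ⟶ A'') (g : B ⟶ B') :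
    HEq (T.tensorator (f ≫ f') g)
      ((α_ (T.left₁ A g) (T.right₁ f B') (T.right₁ f' B')).inv ≫
        T.tensorator f g ▷ T.right₁ f' B' ≫
        (α_ (T.right₁ f B) (T.left₁ A' g) (T.right₁ f' B')).hom ≫
        T.right₁ f B ◁ T.tensorator f' g ≫
        (α_ (T.right₁ f B) (T.right₁ f' B) (T.left₁ A'' g)).inv)
  tensorator_comp_right {A A' B B' B'' : C} (f : A ⟶ A') (g : B ⟶ B') (g' : B' ⟶ B'') :
    HEq (T.tensorator f (g ≫ g'))
      ((α_ (T.left₁ A g) (T.left₁ A g') (T.right₁ f B'')).hom ≫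
        T.left₁ A g ◁ T.tensorator f g' ≫
        (α_ (T.left₁ A g) (T.right₁ f B') (T.left₁ A' g')).inv ≫
        T.tensorator f g ▷ T.left₁ A' g' ≫
        (α_ (T.right₁ f B) (T.left₁ A' g) (T.left₁ A' g')).hom)

/-- Compatibility of the tensor product with the graded linear structure: tensoring with an
object is linear and preserves degrees, and the tensorators have degree zero. -/
structure TensorData.IsGradedLinear {C : Type u} [Bicategory.{w, v} C]
    [∀ a b : C, Preadditive (a ⟶ b)] [∀ a b : C, Linear ℂ (a ⟶ b)] (T : TensorData C)
    (G : Grading C) : Prop where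
  left₂_add (A : C) {B B' : C} {g g' : B ⟶ B'} (β γ : g ⟶ g') :
    T.left₂ A (β + γ) = T.left₂ A β + T.left₂ A γ
  left₂_smul (A : C) {B B' : C} {g g' : B ⟶ B'} (r : ℂ) (β : g ⟶ g') :
    T.left₂ A (r • β) = r • T.left₂ A β
  left₂_mem (A : C) {B B' : C} {g g' : B ⟶ B'} {k : ℤ} {β : g ⟶ g'} (hβ : β ∈ G.piece g g' k) :
    T.left₂ A β ∈ G.piece (T.left₁ A g) (T.left₁ A g') k
  right₂_add {A A' : C} {f f' : A ⟶ A'} (α γ : f ⟶ f') (B : C) :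
    T.right₂ (α + γ) B = T.right₂ α B + T.right₂ γ B
  right₂_smul {A A' : C} {f f' : A ⟶ A'} (r : ℂ) (α : f ⟶ f') (B : C) :
    T.right₂ (r • α) B = r • T.right₂ α B
  right₂_mem {A A' : C} {f f' : A ⟶ A'} {k : ℤ} {α : f ⟶ f'} (hα : α ∈ G.piece f f' k) (B : C) :
    T.right₂ α B ∈ G.piece (T.right₁ f B) (T.right₁ f' B) k
  tensorator_mem {A A' B B' : C} (f : A ⟶ A') (g : B ⟶ B') :
    T.tensorator f g ∈ G.piece (T.left₁ A g ≫ T.right₁ f B') (T.right₁ f B ≫ T.left₁ A' g) 0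

/-! ## The 2-category of diagrammatic categories -/

/-- The objects of the 2-category: natural numbers. -/
structure Obj : Type where
  rank : ℕ

/-- The 1-morphisms from `m` to `n`: for `m = n` the objects of `D_n`, i.e. words in the colors
`1, …, n - 1`; for `m ≠ n` there are none (see `ZObj` below). -/
@[ext]
structure OneHom (m n : Obj) : Type where
  word : List ℕ
  eq : m = n
  isColor : ∀ i ∈ word, IsColor m.rank i

/-- `g ∘₁ f` is the juxtaposition of the words of `g` and `f`. -/
instance : CategoryStruct Obj where
  Hom := OneHom
  id n := ⟨[], rfl, by simp⟩
  comp f g := ⟨g.word ++ f.word, f.eq.trans g.eq, by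
    intro i hi
    rcases List.mem_append.1 hi with h | h
    · have := g.isColor i h
      rwa [← f.eq] at this
    · exact f.isColor i h⟩

lemma OneHom.rank_eq {m n : Obj} (f : m ⟶ n) : n.rank = m.rank := by rw [f.eq]

/-- The 2-morphisms: the morphism spaces of `D_n`. -/
instance (m n : Obj) : Category (m ⟶ n) where
  Hom f g := HomSpace m.rank f.word g.word
  id f := HomSpace.ofEq m.rank rfl
  comp α β := α.comp β
  id_comp α := by
    induction α using HomSpace.ind with | h x hx => exact HomSpace.mk_congr (one_mul x)
  comp_id α := by
    induction α using HomSpace.ind with | h x hx => exact HomSpace.mk_congr (mul_one x)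
  assoc α β γ := by
    induction α using HomSpace.ind with | h x hx =>
    induction β using HomSpace.ind with | h y hy =>
    induction γ using HomSpace.ind with | h z hz => exact HomSpace.mk_congr (mul_assoc x y z)

instance (m n : Obj) : Preadditive (m ⟶ n) where
  homGroup f g := inferInstanceAs (AddCommGroup (HomSpace m.rank f.word g.word))
  add_comp _ _ _ α β γ := by
    induction α using HomSpace.ind with | h x hx =>
    induction β using HomSpace.ind with | h y hy =>
    induction γ using HomSpace.ind with | h z hz => exact HomSpace.mk_congr (add_mul x y z)
  comp_add _ _ _ α β γ := by
    induction α using HomSpace.ind with | h x hx =>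
    induction β using HomSpace.ind with | h y hy =>
    induction γ using HomSpace.ind with | h z hz => exact HomSpace.mk_congr (mul_add x y z)

instance (m n : Obj) : Linear ℂ (m ⟶ n) where
  homModule f g := inferInstanceAs (Module ℂ (HomSpace m.rank f.word g.word))
  smul_comp _ _ _ r α β := by
    induction α using HomSpace.ind with | h x hx =>
    induction β using HomSpace.ind with | h y hy => exact HomSpace.mk_congr (smul_mul_assoc r x y)
  comp_smul _ _ _ α r β := by
    induction α using HomSpace.ind with | h x hx =>
    induction β using HomSpace.ind with | h y hy => exact HomSpace.mk_congr (mul_smul_comm r x y)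

/-- The identity diagram between 1-morphisms with equal words. -/
def isoOfEq {m n : Obj} {f g : m ⟶ n} (h : f.word = g.word) : f ≅ g where
  hom := HomSpace.ofEq m.rank h
  inv := HomSpace.ofEq m.rank h.symm
  hom_inv_id := HomSpace.mk_congr (one_mul 1)
  inv_hom_id := HomSpace.mk_congr (one_mul 1)

lemma mem_linDiag_of_eq {n N : ℕ} (h : n = N) {w w' : List ℕ} {x : DiagAlg}
    (hx : x ∈ linDiag n w w') : x ∈ linDiag N w w' := h ▸ hx

/-- The 2-category `D`: horizontal composition is juxtaposition of diagrams, vertical composition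
is stacking. -/
instance : Bicategory Obj where
  homCategory := inferInstance
  whiskerLeft f _ _ η := HomSpace.whiskerRight (OneHom.rank_eq f) f.word η
  whiskerRight η h := HomSpace.whiskerLeft h.word η
  associator f g h := isoOfEq (List.append_assoc h.word g.word f.word).symm
  leftUnitor f := isoOfEq (List.append_nil f.word)
  rightUnitor f := isoOfEq (List.nil_append f.word)
  whiskerLeft_id f _ := HomSpace.mk_congr (map_one (whisker [] f.word))
  whiskerLeft_comp f g h i η θ := by
    induction η using HomSpace.ind with | h x hx =>
    induction θ using HomSpace.ind with | h y hy =>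
    exact HomSpace.mk_congr (map_mul (whisker [] f.word) x y)
  id_whiskerLeft η := by
    induction η using HomSpace.ind with | h x hx =>
    exact HomSpace.mk_congr (by simp; exact whisker_nil_nil x)
  comp_whiskerLeft f g h h' η := by
    induction η using HomSpace.ind with | h x hx =>
    exact HomSpace.mk_congr (by simp [whisker_whisker]; rfl)
  id_whiskerRight _ g := HomSpace.mk_congr (map_one (whisker g.word []))
  comp_whiskerRight η θ i := by
    induction η using HomSpace.ind with | h x hx =>
    induction θ using HomSpace.ind with | h y hy =>
    exact HomSpace.mk_congr (map_mul (whisker i.word []) x y)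
  whiskerRight_id η := by
    induction η using HomSpace.ind with | h x hx =>
    exact HomSpace.mk_congr (by simp; exact whisker_nil_nil x)
  whiskerRight_comp η g h := by
    induction η using HomSpace.ind with | h x hx =>
    exact HomSpace.mk_congr (by simp [whisker_whisker]; rfl)
  whisker_assoc f g g' η h := by
    induction η using HomSpace.ind with | h x hx =>
    exact HomSpace.mk_congr (by simp [whisker_whisker])
  whisker_exchange {a b c f g h i} η θ := by
    induction η using HomSpace.ind with | h x hx =>
    induction θ using HomSpace.ind with | h y hy =>
    exact HomSpace.mk_eq_mk.2
      (.basic (.interchange (mem_linDiag_of_eq (OneHom.rank_eq f) hy) hx))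
  pentagon f g h i := HomSpace.mk_congr (by simp)
  triangle f g := HomSpace.mk_congr (by simp)

/-- The grading of the spaces of 2-morphisms by the degree of diagrams. -/
def grading : Grading Obj where
  piece f g k := HomSpace.piece f.word g.word k

/-! ## Parabolic induction and shuffle crossings -/

/-- The strand `i` crosses the strands `v` from left to right: `i v → v i`. -/
def crossStrand (i : ℕ) : List ℕ → DiagAlg
  | [] => 1
  | j :: v => slice [] (.cross i j) v * whisker [j] [] (crossStrand i v)

/-- The shuffle crossing `u v → v u`: every strand in `u` crosses every strand in `v` once. -/
def shuffleCrossing : List ℕ → List ℕ → DiagAlg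
  | [], _ => 1
  | i :: u, v => whisker [i] [] (shuffleCrossing u v) * whisker [] u (crossStrand i v)

lemma crossStrand_mem {n i : ℕ} {v : List ℕ} (hi : IsColor n i) (hv : ∀ j ∈ v, IsColor n j)
    (h : ∀ j ∈ v, Distant i j) : crossStrand i v ∈ linDiag n (i :: v) (v ++ [i]) := by
  induction v with
  | nil => exact one_mem_linDiag n rfl
  | cons j v ih =>
    have h1 : slice [] (.cross i j) v ∈ linDiag n (i :: j :: v) (j :: i :: v) :=
      slice_mem_linDiag (g := .cross i j) ⟨hi, hv j (by simp), h j (by simp)⟩ [] v rfl rfl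
    have h2 := whisker_mem_linDiag [j] [] (ih (fun k hk => hv k (by simp [hk]))
      (fun k hk => h k (by simp [hk])))
    simp only [List.append_nil] at h2
    exact mul_mem_linDiag h1 h2

lemma shuffleCrossing_mem {n : ℕ} {u v : List ℕ} (hu : ∀ i ∈ u, IsColor n i)
    (hv : ∀ j ∈ v, IsColor n j) (h : ∀ i ∈ u, ∀ j ∈ v, Distant i j) :
    shuffleCrossing u v ∈ linDiag n (u ++ v) (v ++ u) := by
  induction u with
  | nil => exact one_mem_linDiag n (by simp)
  | cons i u ih =>
    have h1 := whisker_mem_linDiag [i] [] (ih (fun k hk => hu k (by simp [hk]))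
      (fun k hk => h k (by simp [hk])))
    have h2 := whisker_mem_linDiag [] u
      (crossStrand_mem (hu i (by simp)) hv (h i (by simp)))
    simp only [List.append_nil, List.nil_append, List.append_assoc, List.cons_append] at h1 h2
    exact mul_mem_linDiag h1 h2

/-- The monoidal structure on `D`: the unit is `0`, `m ⊗ n = m + n`, tensoring with objects is
given by the color-shifting functors `f ⊗ n = j_{0|n}(f)` and `m ⊗ g = j_{m|0}(g)`, so that
`f ⊠ g = (f ⊗ n) ∘₁ (m ⊗ g)` is parabolic induction, and the tensorators are the shuffle
crossings. -/
def tensorData : TensorData Obj where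
  unit := ⟨0⟩
  obj A B := ⟨A.rank + B.rank⟩
  right₁ {A A'} f B := ⟨f.word.map (0 + ·), by rw [f.eq], by
    intro i hi
    obtain ⟨j, hj, rfl⟩ := List.mem_map.1 hi
    exact (f.isColor j hj).shift (show 0 + A.rank ≤ A.rank + B.rank by omega)⟩
  left₁ A B B' g := ⟨g.word.map (A.rank + ·), by rw [g.eq], by
    intro i hi
    obtain ⟨j, hj, rfl⟩ := List.mem_map.1 hi
    exact (g.isColor j hj).shift le_rfl⟩
  right₂ {A _ _ _} α B := HomSpace.shift 0 (A.rank + B.rank) (by omega) α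
  left₂ A {B _ _ _} β := HomSpace.shift A.rank (A.rank + B.rank) le_rfl β
  tensorator {A A' B B'} f g :=
    HomSpace.mk (shuffleCrossing (f.word.map (0 + ·)) (g.word.map (A.rank + ·))) (by
      have e : (f.word.map (0 + ·)) = f.word := by simp
      have hf : ∀ i ∈ f.word, IsColor A.rank i := f.isColor
      have hg : ∀ j ∈ g.word, IsColor B.rank j := g.isColor
      have key : shuffleCrossing (f.word.map (0 + ·)) (g.word.map (A.rank + ·)) ∈
          linDiag (A.rank + B.rank) (f.word.map (0 + ·) ++ g.word.map (A.rank + ·))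
            (g.word.map (A.rank + ·) ++ f.word.map (0 + ·)) := by
        rw [e]
        refine shuffleCrossing_mem (fun i hi => ?_) (fun j hj => ?_) (fun i hi j hj => ?_)
        · have := hf i hi
          simp only [IsColor] at *
          omega
        · obtain ⟨k, hk, rfl⟩ := List.mem_map.1 hj
          exact (hg k hk).shift le_rfl
        · obtain ⟨k, hk, rfl⟩ := List.mem_map.1 hj
          have h1 := hf i hi
          have h2 := hg k hk
          simp only [IsColor, Distant] at *
          omega
      have h := OneHom.rank_eq f
      show _ ∈ linDiag (A.rank + B.rank) (f.word.map (0 + ·) ++ g.word.map (A.rank + ·))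
        (g.word.map (A'.rank + ·) ++ f.word.map (0 + ·))
      rw [h]
      exact key)

/-! ## Adjoining zero 1-morphisms -/

/-- The objects of the 2-category `D⁰`, obtained from `D` by adjoining a zero object to every
hom-category, i.e. a 1-morphism `none` all of whose spaces of 2-morphisms are zero.  Any
composite with a zero 1-morphism is a zero 1-morphism.  For `m ≠ n` the hom-category from `m` to
`n` has `none` as its only object, with endomorphism algebra `0`; for `m = n` it is `D_n` with a
zero object adjoined. -/
structure ZObj : Type where
  base : Obj

namespace ZObj

/-- Composition of 1-morphisms. -/
def comp₁ {a b c : Obj} : Option (a ⟶ b) → Option (b ⟶ c) → Option (a ⟶ c)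
  | none, _ => none
  | some _, none => none
  | some f, some g => some (f ≫ g)

instance : CategoryStruct ZObj where
  Hom a b := Option (a.base ⟶ b.base)
  id a := some (𝟙 a.base)
  comp f g := comp₁ f g

/-- 2-morphisms. -/
def TwoHom {a b : Obj} : Option (a ⟶ b) → Option (a ⟶ b) → Type
  | none, _ => PUnit
  | some _, none => PUnit
  | some f, some g => f ⟶ g

/-- Identity 2-morphisms. -/
def id₂ {a b : Obj} : (f : Option (a ⟶ b)) → TwoHom f f
  | none => PUnit.unit
  | some f => 𝟙 f

/-- Vertical composition. -/
def comp₂ {a b : Obj} : {f g h : Option (a ⟶ b)} → TwoHom f g → TwoHom g h → TwoHom f h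
  | none, _, _, _, _ => PUnit.unit
  | some _, _, none, _, _ => PUnit.unit
  | some f, none, some h, _, _ => (0 : f ⟶ h)
  | some _, some _, some _, α, β => α ≫ β

instance instAddCommGroup {a b : Obj} :
    (f g : Option (a ⟶ b)) → AddCommGroup (TwoHom f g)
  | none, _ => inferInstanceAs (AddCommGroup PUnit)
  | some _, none => inferInstanceAs (AddCommGroup PUnit)
  | some f, some g => inferInstanceAs (AddCommGroup (f ⟶ g))

instance instModule {a b : Obj} : (f g : Option (a ⟶ b)) → Module ℂ (TwoHom f g)
  | none, _ => inferInstanceAs (Module ℂ PUnit)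
  | some _, none => inferInstanceAs (Module ℂ PUnit)
  | some f, some g => inferInstanceAs (Module ℂ (f ⟶ g))

instance (m n : ZObj) : Category (m ⟶ n) where
  Hom f g := TwoHom f g
  id f := id₂ f
  comp α β := comp₂ α β
  id_comp {f g} α := by
    rcases f with _ | f <;> rcases g with _ | g <;> first | rfl | exact Category.id_comp _
  comp_id {f g} α := by
    rcases f with _ | f <;> rcases g with _ | g <;> first | rfl | exact Category.comp_id _
  assoc {f g h i} α β γ := by
    rcases f with _ | f <;> rcases g with _ | g <;> rcases h with _ | h <;>
      rcases i with _ | i <;>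
      first
        | rfl
        | exact Category.assoc _ _ _
        | exact Limits.zero_comp
        | exact Limits.comp_zero.symm

instance (m n : ZObj) : Preadditive (m ⟶ n) where
  homGroup f g := instAddCommGroup f g
  add_comp f g h α β γ := by
    rcases f with _ | f
    · rfl
    rcases h with _ | h
    · rfl
    rcases g with _ | g
    · exact (add_zero (0 : f ⟶ h)).symm
    · exact Preadditive.add_comp (C := m.base ⟶ n.base) _ _ _ _ _ _
  comp_add f g h α β γ := by
    rcases f with _ | f
    · rfl
    rcases h with _ | h
    · rfl
    rcases g with _ | g
    · exact (add_zero (0 : f ⟶ h)).symm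
    · exact Preadditive.comp_add (C := m.base ⟶ n.base) _ _ _ _ _ _

instance (m n : ZObj) : Linear ℂ (m ⟶ n) where
  homModule f g := instModule f g
  smul_comp f g h r α β := by
    rcases f with _ | f
    · rfl
    rcases h with _ | h
    · rfl
    rcases g with _ | g
    · exact (smul_zero (A := f ⟶ h) r).symm
    · exact Linear.smul_comp (C := m.base ⟶ n.base) _ _ _ _ _ _
  comp_smul f g h α r β := by
    rcases f with _ | f
    · rfl
    rcases h with _ | h
    · rfl
    rcases g with _ | g
    · exact (smul_zero (A := f ⟶ h) r).symm
    · exact Linear.comp_smul (C := m.base ⟶ n.base) _ _ _ _ _ _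

/-- Whiskering. -/
def whiskerLeft {a b c : Obj} : (f : Option (a ⟶ b)) → {g h : Option (b ⟶ c)} → TwoHom g h →
    TwoHom (comp₁ f g) (comp₁ f h)
  | none, _, _, _ => PUnit.unit
  | some _, none, _, _ => PUnit.unit
  | some _, some _, none, _ => PUnit.unit
  | some f, some g, some h, η => f ◁ (η : g ⟶ h)

/-- Whiskering. -/
def whiskerRight {a b c : Obj} : {f g : Option (a ⟶ b)} → TwoHom f g → (h : Option (b ⟶ c)) →
    TwoHom (comp₁ f h) (comp₁ g h)
  | none, _, _, _ => PUnit.unit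
  | some _, none, _, none => PUnit.unit
  | some _, none, _, some _ => PUnit.unit
  | some _, some _, _, none => PUnit.unit
  | some f, some g, η, some h => (η : f ⟶ g) ▷ h

/-- An isomorphism between nonzero 1-morphisms. -/
def someIso {a b : ZObj} {f g : a.base ⟶ b.base} (e : f ≅ g) :
    (show a ⟶ b from some f) ≅ (show a ⟶ b from some g) where
  hom := e.hom
  inv := e.inv
  hom_inv_id := e.hom_inv_id
  inv_hom_id := e.inv_hom_id

/-- Associators. -/
def associator {a b c d : ZObj} : (f : a ⟶ b) → (g : b ⟶ c) → (h : c ⟶ d) →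
    ((f ≫ g) ≫ h ≅ f ≫ g ≫ h)
  | none, _, _ => Iso.refl (show a ⟶ d from none)
  | some _, none, _ => Iso.refl (show a ⟶ d from none)
  | some _, some _, none => Iso.refl (show a ⟶ d from none)
  | some f, some g, some h => someIso (α_ f g h)

/-- Unitors. -/
def leftUnitor {a b : ZObj} : (f : a ⟶ b) → (𝟙 a ≫ f ≅ f)
  | none => Iso.refl (show a ⟶ b from none)
  | some f => someIso (λ_ f)

/-- Unitors. -/
def rightUnitor {a b : ZObj} : (f : a ⟶ b) → (f ≫ 𝟙 b ≅ f)
  | none => Iso.refl (show a ⟶ b from none)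
  | some f => someIso (ρ_ f)

/-- The 2-category `D⁰`. -/
instance : Bicategory ZObj where
  homCategory := inferInstance
  whiskerLeft f _ _ η := whiskerLeft f η
  whiskerRight η h := whiskerRight η h
  associator := associator
  leftUnitor := leftUnitor
  rightUnitor := rightUnitor
  whiskerLeft_id f g := by
    rcases f with _ | f <;> rcases g with _ | g <;>
      first | rfl | exact Bicategory.whiskerLeft_id f g
  whiskerLeft_comp f g h i η θ := by
    rcases f with _ | f <;> rcases g with _ | g <;> rcases h with _ | h <;>
      rcases i with _ | i <;>
      first | rfl | exact Bicategory.whiskerLeft_comp f _ _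
  id_whiskerLeft {a b f g} η := by
    rcases f with _ | f <;> rcases g with _ | g <;>
      first | rfl | exact Bicategory.id_whiskerLeft (B := Obj) _
  comp_whiskerLeft f g h h' η := by
    rcases f with _ | f <;> rcases g with _ | g <;> rcases h with _ | h <;>
      rcases h' with _ | h' <;>
      first | rfl | exact Bicategory.comp_whiskerLeft f g _
  id_whiskerRight f g := by
    rcases f with _ | f <;> rcases g with _ | g <;>
      first | rfl | exact Bicategory.id_whiskerRight f g
  comp_whiskerRight {a b c f g h} η θ i := by
    rcases f with _ | f <;> rcases g with _ | g <;> rcases h with _ | h <;>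
      rcases i with _ | i <;>
      first | rfl | exact Bicategory.comp_whiskerRight (B := Obj) _ _ i
  whiskerRight_id {a b f g} η := by
    rcases f with _ | f <;> rcases g with _ | g <;>
      first | rfl | exact Bicategory.whiskerRight_id (B := Obj) _
  whiskerRight_comp {a b c d f f'} η g h := by
    rcases f with _ | f <;> rcases f' with _ | f' <;> rcases g with _ | g <;>
      rcases h with _ | h <;>
      first | rfl | exact Bicategory.whiskerRight_comp (B := Obj) _ g h
  whisker_assoc f g g' η h := by
    rcases f with _ | f <;> rcases g with _ | g <;> rcases g' with _ | g' <;>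
      rcases h with _ | h <;>
      first | rfl | exact Bicategory.whisker_assoc f _ h
  whisker_exchange {a b c f g h i} η θ := by
    rcases f with _ | f <;> rcases g with _ | g <;> rcases h with _ | h <;>
      rcases i with _ | i <;>
      first | rfl | exact Bicategory.whisker_exchange (B := Obj) _ _
  pentagon f g h i := by
    rcases f with _ | f <;> rcases g with _ | g <;> rcases h with _ | h <;>
      rcases i with _ | i <;>
      first | rfl | exact Bicategory.pentagon f g h i
  triangle f g := by
    rcases f with _ | f <;> rcases g with _ | g <;>
      first | rfl | exact Bicategory.triangle f g

/-- The graded pieces of the spaces of 2-morphisms (everything is zero if the source or the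
target is zero). -/
def piece {a b : Obj} : (f g : Option (a ⟶ b)) → ℤ → Submodule ℂ (TwoHom f g)
  | none, _, _ => ⊥
  | some _, none, _ => ⊥
  | some f, some g, k => SoergelDiagrammatics.grading.piece f g k

/-- The grading of the spaces of 2-morphisms of `D⁰`. -/
def grading : Grading ZObj where
  piece f g k := piece f g k

/-- Tensoring 2-morphisms with an object. -/
def right₂ {A A' : Obj} : {f f' : Option (A ⟶ A')} → TwoHom f f' → (B : Obj) →
    TwoHom (f.map fun f => tensorData.right₁ f B) (f'.map fun f => tensorData.right₁ f B)
  | none, _, _, _ => PUnit.unit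
  | some _, none, _, _ => PUnit.unit
  | some f, some f', α, B => tensorData.right₂ (f := f) (f' := f') α B

/-- Tensoring 2-morphisms with an object. -/
def left₂ (A : Obj) {B B' : Obj} : {g g' : Option (B ⟶ B')} → TwoHom g g' →
    TwoHom (g.map (tensorData.left₁ A)) (g'.map (tensorData.left₁ A))
  | none, _, _ => PUnit.unit
  | some _, none, _ => PUnit.unit
  | some g, some g', β => tensorData.left₂ A (g := g) (g' := g') β

/-- The tensorators. -/
def tensorator {A A' B B' : Obj} : (f : Option (A ⟶ A')) → (g : Option (B ⟶ B')) →
    TwoHom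
      (comp₁ (g.map (tensorData.left₁ A)) (f.map fun f => tensorData.right₁ f B'))
      (comp₁ (f.map fun f => tensorData.right₁ f B) (g.map (tensorData.left₁ A')))
  | none, none => PUnit.unit
  | none, some _ => PUnit.unit
  | some _, none => PUnit.unit
  | some f, some g => tensorData.tensorator f g

/-- The monoidal structure on `D⁰`: the one of `D` on nonzero 1-morphisms, and the tensor product
of a zero 1-morphism with an object is a zero 1-morphism. -/
def tensorData : TensorData ZObj where
  unit := ⟨SoergelDiagrammatics.tensorData.unit⟩
  obj A B := ⟨SoergelDiagrammatics.tensorData.obj A.base B.base⟩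
  right₁ {A A'} f B :=
    Option.map (fun f : A.base ⟶ A'.base => SoergelDiagrammatics.tensorData.right₁ f B.base) f
  left₁ A _ _ g := Option.map (SoergelDiagrammatics.tensorData.left₁ A.base) g
  right₂ α B := right₂ α B.base
  left₂ A _ _ _ _ β := left₂ A.base β
  tensorator f g := tensorator f g

end ZObj

end SoergelDiagrammatics

/-!
Morphisms of `D_n` are computed with as elements of the algebra `DiagAlg`, modulo the relation `Rel`
of being equal in `D_n`.

The strictness axioms hold because words and sequences of slices are concatenated and relabelled
strictly (`HomSpace.heq_mk_of_eq`), and `D⁰` inherits everything from `D` by distinguishing whether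
the 1-morphisms involved are zero. Two points need an argument.

*Shuffle crossings are invertible and natural.* The colors of `D_m` are distant from the colors of
`D_n` shifted by `m`. Rotating one of two successive crossings of distant strands turns them into a
merge between two crossings, which is resolved by the compatibilities of crossings with merges and
enddots and by the snake relation; hence the two crossings cancel (`rel_cross_cross`). Naturality
says that a generating morphism slides through a distant strand. For merges, enddots, vertices and
boxes this is among the relations (for boxes, polynomial forcing with vanishing Demazure operator).
For cups it follows by rotating a crossing, since crossings are invertible (`Slides.cup`), and
startdots and splits are obtained from cups, enddots and merges. Sliding from the other side
follows by composing with inverse crossings (`Slides.mirror`).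

*The morphism spaces are graded.* The projection of `DiagAlg` to sequences of slices of degree `k`
preserves the tensor ideal (`InIdeal.degreePart`): every defining relation is homogeneous, except
for the interchange law, which is bilinear, and polynomial forcing, which is compatible with taking
homogeneous components of polynomials. So the projection acts on the morphism spaces, where it
separates the pieces (`HomSpace.isInternal`).
-/

namespace SoergelDiagrammatics

/-! ### Calculus of diagrams modulo the defining relations -/

/-- `Rel n w w' x y`: `x` and `y` are linear combinations of diagrams of `D_n` from `w` to `w'`
which represent the same morphism. -/
structure Rel (n : ℕ) (w w' : List ℕ) (x y : DiagAlg) : Prop where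
  left_mem : x ∈ linDiag n w w'
  right_mem : y ∈ linDiag n w w'
  sub_mem : InIdeal n w w' (x - y)

namespace Rel

variable {n : ℕ} {u v w w' v' : List ℕ} {x y z x' y' : DiagAlg}

lemma refl (hx : x ∈ linDiag n w w') : Rel n w w' x x :=
  ⟨hx, hx, by rw [sub_self]; exact .zero w w'⟩

lemma of_eq (hx : x ∈ linDiag n w w') (h : x = y) : Rel n w w' x y := h ▸ refl hx

lemma symm (h : Rel n w w' x y) : Rel n w w' y x :=
  ⟨h.2, h.1, by simpa using h.3.smul (-1)⟩

lemma trans (h : Rel n w w' x y) (h' : Rel n w w' y z) : Rel n w w' x z :=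
  ⟨h.1, h'.2, by simpa using h.3.add h'.3⟩

lemma mul (h : Rel n u v x x') (h' : Rel n v w y y') : Rel n u w (x * y) (x' * y') :=
  ⟨mul_mem_linDiag h.1 h'.1, mul_mem_linDiag h.2 h'.2, by
    have := (h.3.comp_right h'.1).add (h'.3.comp_left h.2)
    rwa [sub_mul, mul_sub, sub_add_sub_cancel] at this⟩

lemma mul_left (hx : x ∈ linDiag n u v) (h : Rel n v w y y') : Rel n u w (x * y) (x * y') :=
  (refl hx).mul h

lemma mul_right (h : Rel n u v x x') (hy : y ∈ linDiag n v w) :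
    Rel n u w (x * y) (x' * y) :=
  h.mul (refl hy)

lemma whisker (a b : List ℕ) (h : Rel n w w' x y) :
    Rel n (a ++ w ++ b) (a ++ w' ++ b) (whisker a b x) (SoergelDiagrammatics.whisker a b y) :=
  ⟨whisker_mem_linDiag a b h.1, whisker_mem_linDiag a b h.2, by
    rw [← map_sub]; exact h.3.whisker a b⟩

lemma of_basic (hx : x ∈ linDiag n w w') (hy : y ∈ linDiag n w w')
    (h : Basic n w w' (x - y)) : Rel n w w' x y :=
  ⟨hx, hy, .basic h⟩

lemma add (h : Rel n w w' x y) (h' : Rel n w w' x' y') : Rel n w w' (x + x') (y + y') :=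
  ⟨add_mem h.1 h'.1, add_mem h.2 h'.2, by
    have := h.3.add h'.3
    rwa [sub_add_sub_comm] at this⟩

lemma smul (c : ℂ) (h : Rel n w w' x y) : Rel n w w' (c • x) (c • y) :=
  ⟨Submodule.smul_mem _ c h.1, Submodule.smul_mem _ c h.2, by
    rw [← smul_sub]; exact h.3.smul c⟩

end Rel

lemma whisker_left_mem {n : ℕ} (u : List ℕ) {w w' : List ℕ} {x : DiagAlg}
    (hx : x ∈ linDiag n w w') : whisker u [] x ∈ linDiag n (u ++ w) (u ++ w') := by
  simpa using whisker_mem_linDiag u [] hx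

lemma whisker_right_mem {n : ℕ} (v : List ℕ) {w w' : List ℕ} {x : DiagAlg}
    (hx : x ∈ linDiag n w w') : whisker [] v x ∈ linDiag n (w ++ v) (w' ++ v) :=
  whisker_mem_linDiag [] v hx

lemma Rel.whisker_left {n : ℕ} (u : List ℕ) {w w' : List ℕ} {x y : DiagAlg}
    (h : Rel n w w' x y) :
    Rel n (u ++ w) (u ++ w') (SoergelDiagrammatics.whisker u [] x)
      (SoergelDiagrammatics.whisker u [] y) := by
  simpa using h.whisker u []

lemma Rel.whisker_right {n : ℕ} (v : List ℕ) {w w' : List ℕ} {x y : DiagAlg}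
    (h : Rel n w w' x y) :
    Rel n (w ++ v) (w' ++ v) (SoergelDiagrammatics.whisker [] v x)
      (SoergelDiagrammatics.whisker [] v y) :=
  h.whisker [] v

lemma rel_interchange {n : ℕ} {w w' v v' : List ℕ} {f g : DiagAlg}
    (hf : f ∈ linDiag n w w') (hg : g ∈ linDiag n v v') :
    Rel n (w ++ v) (w' ++ v') (whisker [] v f * whisker w' [] g)
      (whisker w [] g * whisker [] v' f) :=
  .of_basic (mul_mem_linDiag (whisker_right_mem v hf) (whisker_left_mem w' hg))
    (mul_mem_linDiag (whisker_left_mem w hg) (whisker_right_mem v' hf)) (.interchange hf hg)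

@[simp]
lemma whisker_slice (u v a b : List ℕ) (g : Gen) :
    whisker u v (slice a g b) = slice (u ++ a) g (b ++ v) := by
  simp [slice, whisker_diag]

lemma slice_mem {n : ℕ} {g : Gen} (hg : g.Valid n) (u v : List ℕ) :
    slice u g v ∈ linDiag n (u ++ g.dom ++ v) (u ++ g.cod ++ v) :=
  slice_mem_linDiag hg u v rfl rfl

/-! ### Cups, caps and crossings -/

section Generators

variable {n i j : ℕ}

lemma cap_mem (hi : IsColor n i) : cap i ∈ linDiag n [i, i] [] :=
  mul_mem_linDiag (slice_mem (g := .merge i) hi [] []) (slice_mem (g := .enddot i) hi [] [])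

lemma cup_mem (hi : IsColor n i) : cup i ∈ linDiag n [] [i, i] :=
  mul_mem_linDiag (slice_mem (g := .startdot i) hi [] []) (slice_mem (g := .split i) hi [] [])

lemma whisker_cap (u v : List ℕ) (i : ℕ) :
    whisker u v (cap i) = slice u (.merge i) v * slice u (.enddot i) v := by
  simp [cap]

lemma whisker_cup (u v : List ℕ) (i : ℕ) :
    whisker u v (cup i) = slice u (.startdot i) v * slice u (.split i) v := by
  simp [cup]

/-- Half of the snake relation, with a merge in place of a cap. -/
lemma rel_cup_merge (hi : IsColor n i) :
    Rel n [i] [i, i] (whisker [] [i] (cup i) * slice [i] (.merge i) [])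
      (slice [] (.split i) []) := by
  have m := slice_mem (g := .merge i) hi
  have s := slice_mem (g := .split i) hi
  have t := slice_mem (g := .startdot i) hi
  have h1 : Rel n [i, i] [i, i] _ _ := .of_basic (mul_mem_linDiag (s [] [i]) (m [i] []))
    (mul_mem_linDiag (m [] []) (s [] [])) (.frobenius_left hi)
  have h2 : Rel n [i] [i] _ _ := .of_basic (mul_mem_linDiag (t [] [i]) (m [] []))
    (one_mem_linDiag n rfl) (.unit_left hi)
  have h3 := (Rel.mul_left (t [] [i]) h1).trans
    (.trans (.of_eq (mul_mem_linDiag (t [] [i]) (mul_mem_linDiag (m [] []) (s [] [])))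
      (mul_assoc _ _ _).symm) (h2.mul_right (s [] [])))
  simpa [whisker_cup, mul_assoc, Gen.dom, Gen.cod] using h3

/-- The snake relation. -/
lemma rel_snake_left (hi : IsColor n i) :
    Rel n [i] [i] (whisker [] [i] (cup i) * whisker [i] [] (cap i)) 1 := by
  have e := slice_mem (g := .enddot i) hi
  have s := slice_mem (g := .split i) hi
  have h := ((rel_cup_merge hi).mul_right (e [i] [])).trans
    (.of_basic (mul_mem_linDiag (s [] []) (e [i] [])) (one_mem_linDiag n rfl) (.counit_right hi))
  simpa [whisker_cap, mul_assoc, Gen.dom, Gen.cod] using h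

/-- A distant crossing is symmetric in the two colors. -/
lemma Distant.symm (h : Distant i j) : Distant j i := Or.symm h

lemma cross_mem (hi : IsColor n i) (hj : IsColor n j) (hij : Distant i j) (u v : List ℕ) :
    slice u (.cross i j) v ∈ linDiag n (u ++ [i, j] ++ v) (u ++ [j, i] ++ v) :=
  slice_mem (g := .cross i j) ⟨hi, hj, hij⟩ u v

lemma rel_cross_enddot (hi : IsColor n i) (hj : IsColor n j) (hij : Distant i j) :
    Rel n [i, j] [j] (slice [] (.cross i j) [] * slice [j] (.enddot i) [])
      (slice [] (.enddot i) [j]) :=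
  .of_basic (mul_mem_linDiag (cross_mem hi hj hij [] []) (slice_mem (g := .enddot i) hi [j] []))
    (slice_mem (g := .enddot i) hi [] [j]) (.cross_enddot hi hj hij)

lemma rel_cross_merge (hi : IsColor n i) (hj : IsColor n j) (hij : Distant i j) :
    Rel n [i, i, j] [j, i] (slice [] (.merge i) [j] * slice [] (.cross i j) [])
      (slice [i] (.cross i j) [] * slice [] (.cross i j) [i] * slice [j] (.merge i) []) :=
  .of_basic (mul_mem_linDiag (slice_mem (g := .merge i) hi [] [j]) (cross_mem hi hj hij [] []))
    (mul_mem_linDiag (mul_mem_linDiag (cross_mem hi hj hij [i] []) (cross_mem hi hj hij [] [i]))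
      (slice_mem (g := .merge i) hi [j] [])) (.cross_merge hi hj hij)

lemma rel_cross_rotate_right (hi : IsColor n i) (hj : IsColor n j) (hij : Distant i j) :
    Rel n [j, i] [i, j] (whisker [] [j, i] (cup i) * slice [i] (.cross i j) [i] *
      whisker [i, j] [] (cap i)) (slice [] (.cross j i) []) :=
  .of_basic (mul_mem_linDiag (mul_mem_linDiag
      (whisker_right_mem [j, i] (cup_mem hi) :) (cross_mem hi hj hij [i] [i]))
      (whisker_left_mem [i, j] (cap_mem hi) :))
    (cross_mem hj hi hij.symm [] []) (.cross_rotate_right hi hj hij)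

lemma rel_cross_rotate_left (hi : IsColor n i) (hj : IsColor n j) (hij : Distant i j) :
    Rel n [j, i] [i, j] (whisker [j, i] [] (cup j) * slice [j] (.cross i j) [j] *
      whisker [] [i, j] (cap j)) (slice [] (.cross j i) []) :=
  .of_basic (mul_mem_linDiag (mul_mem_linDiag
      (whisker_left_mem [j, i] (cup_mem hj) :) (cross_mem hi hj hij [j] [j]))
      (whisker_right_mem [i, j] (cap_mem hj) :))
    (cross_mem hj hi hij.symm [] []) (.cross_rotate_left hi hj hij)

/-- Two distant strands crossing twice may be pulled apart. -/
lemma rel_cross_cross (hi : IsColor n i) (hj : IsColor n j) (hij : Distant i j) :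
    Rel n [i, j] [i, j] (slice [] (.cross i j) [] * slice [] (.cross j i) []) 1 := by
  have X := cross_mem hi hj hij
  have c2 := (whisker_right_mem [i, j] (cup_mem hi) :)
  have c3 := (whisker_left_mem [i, j] (cap_mem hi) :)
  have h2 := rel_interchange (cup_mem hi) (X [] [])
  have h3 := (rel_cross_merge hi hj hij).whisker_left [i]
  have h4 := (rel_cross_enddot hi hj hij).whisker_left [i]
  have h5 := (rel_snake_left hi).whisker_right [j]
  -- rotate the upper crossing and move the resulting cup to the bottom
  have A := Rel.mul_left (X [] []) (rel_cross_rotate_right hi hj hij).symm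
  have B := h2.symm.mul_right (mul_mem_linDiag (X [i] [i]) c3)
  -- pull the two crossings through the merge, then apply the snake relation
  have C := Rel.mul_left c2 (h3.symm.mul_right (slice_mem (g := .enddot i) hi [i, j] []))
  have D := Rel.mul_left c2 (Rel.mul_left (slice_mem (g := .merge i) hi [i] [j]) h4)
  simp only [map_mul, whisker_cap, whisker_slice, whisker_whisker, mul_assoc, List.append_nil,
    List.nil_append, List.cons_append, map_one, Gen.cod] at A B C D h5 ⊢
  exact A.trans (B.trans (C.trans (D.trans h5)))

end Generators

/-! ### Shuffle crossings -/

/-- The strands `u` may cross the strands `v` in `D_n`. -/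
structure Far (n : ℕ) (u v : List ℕ) : Prop where
  left : ∀ i ∈ u, IsColor n i
  right : ∀ j ∈ v, IsColor n j
  distant : ∀ i ∈ u, ∀ j ∈ v, Distant i j

namespace Far

variable {n i : ℕ} {u u' v v' : List ℕ}

lemma symm (h : Far n u v) : Far n v u :=
  ⟨h.2, h.1, fun i hi j hj => (h.3 j hj i hi).symm⟩

lemma append_left_iff : Far n (u ++ u') v ↔ Far n u v ∧ Far n u' v := by
  constructor
  · intro h
    exact ⟨⟨fun i hi => h.1 i (by simp [hi]), h.2, fun i hi => h.3 i (by simp [hi])⟩,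
      ⟨fun i hi => h.1 i (by simp [hi]), h.2, fun i hi => h.3 i (by simp [hi])⟩⟩
  · rintro ⟨h, h'⟩
    refine ⟨fun i hi => ?_, h.2, fun i hi => ?_⟩ <;> rcases List.mem_append.1 hi with hi | hi
    exacts [h.1 i hi, h'.1 i hi, h.3 i hi, h'.3 i hi]

lemma append_right_iff : Far n u (v ++ v') ↔ Far n u v ∧ Far n u v' :=
  ⟨fun h => (append_left_iff.1 h.symm).imp symm symm,
    fun h => (append_left_iff.2 (h.imp symm symm)).symm⟩

lemma cons_left_iff : Far n (i :: u) v ↔ Far n [i] v ∧ Far n u v := append_left_iff (u := [i])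

lemma cons_right_iff : Far n u (i :: v) ↔ Far n u [i] ∧ Far n u v := append_right_iff (v := [i])

lemma crossing_mem (h : Far n u v) : shuffleCrossing u v ∈ linDiag n (u ++ v) (v ++ u) :=
  shuffleCrossing_mem h.1 h.2 h.3

lemma crossStrand_mem (h : Far n [i] v) : crossStrand i v ∈ linDiag n (i :: v) (v ++ [i]) :=
  SoergelDiagrammatics.crossStrand_mem (h.1 i (by simp)) h.2 (h.3 i (by simp))

end Far

lemma crossStrand_append (i : ℕ) (v v' : List ℕ) :
    crossStrand i (v ++ v') =
      whisker [] v' (crossStrand i v) * whisker v [] (crossStrand i v') := by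
  induction v with
  | nil => simp [crossStrand, whisker_nil_nil]
  | cons j v ih => simp [crossStrand, ih, whisker_whisker, mul_assoc]

/-- Holds on the nose, since `shuffleCrossing` is defined by recursion on its first word. -/
lemma shuffleCrossing_append_left (u u' v : List ℕ) :
    shuffleCrossing (u ++ u') v =
      whisker u [] (shuffleCrossing u' v) * whisker [] u' (shuffleCrossing u v) := by
  induction u with
  | nil => simp [shuffleCrossing, whisker_nil_nil]
  | cons i u ih => simp [shuffleCrossing, ih, whisker_whisker, mul_assoc]

lemma shuffleCrossing_nil_right (u : List ℕ) : shuffleCrossing u [] = 1 := by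
  induction u with
  | nil => rfl
  | cons i u ih => simp [shuffleCrossing, ih, crossStrand]

/-- In contrast to `shuffleCrossing_append_left`, this only holds modulo the interchange law. -/
lemma rel_shuffleCrossing_append_right {n : ℕ} {u v v' : List ℕ} (h : Far n u v)
    (h' : Far n u v') :
    Rel n (u ++ v ++ v') (v ++ v' ++ u) (shuffleCrossing u (v ++ v'))
      (whisker [] v' (shuffleCrossing u v) * whisker v [] (shuffleCrossing u v')) := by
  induction u with
  | nil => exact .of_eq (one_mem_linDiag n (by simp)) (by simp [shuffleCrossing])
  | cons i u ih =>
    obtain ⟨hi, hu⟩ := Far.cons_left_iff.1 h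
    obtain ⟨hi', hu'⟩ := Far.cons_left_iff.1 h'
    have c := (crossStrand_append i v v') ▸ (Far.append_right_iff.2 ⟨hi, hi'⟩).crossStrand_mem
    have A := ((ih hu hu').whisker_left [i]).mul_right (by
      simpa using whisker_right_mem u c)
    have B := Rel.mul_left (by simpa using whisker_mem_linDiag [i] v' hu.crossing_mem)
      ((rel_interchange hi.crossStrand_mem hu'.crossing_mem).symm.mul_right
        (by simpa using whisker_mem_linDiag v u hi'.crossStrand_mem))
    simp only [shuffleCrossing, crossStrand_append, map_mul, whisker_whisker, mul_assoc,
      List.append_nil, List.nil_append, List.cons_append, List.append_assoc] at A B ⊢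
    exact A.trans B

lemma rel_crossStrand_inverse {n i : ℕ} {v : List ℕ} (h : Far n [i] v) :
    Rel n (i :: v) (i :: v) (crossStrand i v * shuffleCrossing v [i]) 1 := by
  induction v with
  | nil =>
    exact .of_eq (mul_mem_linDiag h.crossStrand_mem (by simpa using h.symm.crossing_mem))
      (by simp [crossStrand, shuffleCrossing])
  | cons j v ih =>
    obtain ⟨hj, hv⟩ := Far.cons_right_iff.1 h
    have hi := h.1 i (by simp)
    have hj' := hj.2 j (by simp)
    have d := hj.3 i (by simp) j (by simp)
    have A := Rel.mul_left (cross_mem hi hj' d [] v) ((((ih hv).whisker_left [j]).mul_right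
      (cross_mem hj' hi d.symm [] v)))
    have B := (rel_cross_cross hi hj' d).whisker_right v
    simp only [shuffleCrossing, crossStrand, map_mul, whisker_slice, mul_assoc,
      List.append_nil, List.nil_append, List.cons_append, map_one, one_mul,
      mul_one] at A B ⊢
    exact A.trans B

/-- Shuffle crossings are invertible. -/
lemma rel_shuffleCrossing_inverse {n : ℕ} {u v : List ℕ} (h : Far n u v) :
    Rel n (u ++ v) (u ++ v) (shuffleCrossing u v * shuffleCrossing v u) 1 := by
  induction u with
  | nil =>
    exact .of_eq (mul_mem_linDiag h.crossing_mem h.symm.crossing_mem)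
      (by simp [shuffleCrossing, shuffleCrossing_nil_right])
  | cons i u ih =>
    obtain ⟨hi, hu⟩ := Far.cons_left_iff.1 h
    have R := rel_shuffleCrossing_append_right hi.symm hu.symm
    rw [List.append_assoc] at R
    have A := Rel.mul_left h.crossing_mem R
    have B := Rel.mul_left (by simpa using whisker_left_mem [i] hu.crossing_mem)
      (((rel_crossStrand_inverse hi).whisker_right u).mul_right
        (by simpa using whisker_left_mem [i] hu.symm.crossing_mem))
    have C := (ih hu).whisker_left [i]
    simp only [shuffleCrossing, map_mul, mul_assoc, List.nil_append, List.cons_append, map_one,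
      one_mul] at A B C ⊢
    exact A.trans (B.trans C)

/-! ### Sliding diagrams through strands -/

/-- The strands `v` slide through the diagram `x` from right to left. -/
def Slides (n : ℕ) (w w' : List ℕ) (x : DiagAlg) (v : List ℕ) : Prop :=
  Rel n (w ++ v) (v ++ w') (whisker [] v x * shuffleCrossing w' v)
    (shuffleCrossing w v * whisker v [] x)

namespace Slides

variable {n : ℕ} {w w' w'' v v' : List ℕ} {x y : DiagAlg}

lemma one (h : Far n w v) : Slides n w w 1 v :=
  .of_eq (mul_mem_linDiag (by simpa using one_mem_linDiag n rfl) h.crossing_mem) (by simp)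

lemma congr (h : Slides n w w' x v) (hw : Far n w v) (hw' : Far n w' v) (e : Rel n w w' x y) :
    Slides n w w' y v :=
  ((e.whisker_right v).symm.mul_right hw'.crossing_mem).trans
    (h.trans (.mul_left hw.crossing_mem (e.whisker_left v)))

lemma mul (h : Slides n w w' x v) (h' : Slides n w' w'' y v) (hx : x ∈ linDiag n w w')
    (hy : y ∈ linDiag n w' w'') : Slides n w w'' (x * y) v := by
  have A := Rel.mul_left (whisker_right_mem v hx) h'
  have B := Rel.mul_right h (whisker_left_mem v hy)
  simp only [Slides, map_mul, mul_assoc] at A B ⊢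
  exact A.trans B

/-- The crossings with the strands `a` and `b` are moved past `x` by the interchange law. -/
lemma whisker (h : Slides n w w' x v) (hx : x ∈ linDiag n w w') {a b : List ℕ} (ha : Far n a v)
    (hb : Far n b v) (hw' : Far n w' v) (hw : Far n w v) :
    Slides n (a ++ w ++ b) (a ++ w' ++ b) (whisker a b x) v := by
  have A := ((rel_interchange hx hb.crossing_mem).whisker_left a).mul_right
    (by simpa using whisker_right_mem b (Far.append_left_iff.2 ⟨ha, hw'⟩).crossing_mem)
  have B := Rel.mul_left (by simpa using whisker_left_mem (a ++ w) hb.crossing_mem)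
    ((Rel.whisker a b h).mul_right
      (by simpa using whisker_right_mem (w' ++ b) ha.crossing_mem))
  have C := Rel.mul_left (by simpa using whisker_left_mem (a ++ w) hb.crossing_mem)
    (Rel.mul_left (by simpa using whisker_mem_linDiag a b hw.crossing_mem)
      (rel_interchange ha.crossing_mem (whisker_right_mem b hx)).symm)
  simp only [Slides, shuffleCrossing_append_left, map_mul, whisker_whisker, mul_assoc,
      List.append_nil, List.nil_append, List.append_assoc] at A B C ⊢
  exact A.trans (B.trans C)

lemma append (h : Slides n w w' x v) (h' : Slides n w w' x v') (hx : x ∈ linDiag n w w')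
    (hw : Far n w v) (hw' : Far n w' v) (gw : Far n w v') (gw' : Far n w' v') :
    Slides n w w' x (v ++ v') := by
  have A := Rel.mul_left (whisker_right_mem (v ++ v') hx)
    (by simpa using rel_shuffleCrossing_append_right hw' gw')
  have B := (Rel.whisker_right v' h).mul_right
    (by simpa using whisker_left_mem v gw'.crossing_mem)
  have C := Rel.mul_left (whisker_right_mem v' hw.crossing_mem)
    (by simpa using Rel.whisker_left v h')
  have D := (rel_shuffleCrossing_append_right hw gw).symm.mul_right
    (by simpa using whisker_left_mem (v ++ v') hx)
  simp only [Slides, map_mul, whisker_whisker, mul_assoc,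
      List.append_nil, List.nil_append, List.append_assoc] at A B C D ⊢
  exact A.trans (B.trans (C.trans D))

lemma nil (hx : x ∈ linDiag n w w') : Slides n w w' x [] := by
  refine .of_eq ?_ ?_ <;> simp [shuffleCrossing_nil_right, whisker_nil_nil, hx]

lemma add (h : Slides n w w' x v) (h' : Slides n w w' y v) : Slides n w w' (x + y) v := by
  simpa [Slides, add_mul, mul_add] using Rel.add h h'

lemma smul (c : ℂ) (h : Slides n w w' x v) : Slides n w w' (c • x) v := by
  simpa [Slides] using Rel.smul c h

/-- Since shuffle crossings are invertible, strands also slide through a diagram from left to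
right. -/
lemma mirror (h : Slides n w w' x v) (hw : Far n w v) (hw' : Far n w' v)
    (hx : x ∈ linDiag n w w') :
    Rel n (v ++ w) (w' ++ v) (SoergelDiagrammatics.whisker v [] x * shuffleCrossing v w')
      (shuffleCrossing v w * SoergelDiagrammatics.whisker [] v x) := by
  have m := (whisker_left_mem v hx :)
  have m' := (whisker_right_mem v hx :)
  have A := (rel_shuffleCrossing_inverse hw.symm).symm.mul_right
    (mul_mem_linDiag m hw'.symm.crossing_mem)
  have B := Rel.mul_left hw.symm.crossing_mem (Rel.mul_right h.symm hw'.symm.crossing_mem)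
  have C := Rel.mul_left hw.symm.crossing_mem
    (Rel.mul_left m' (rel_shuffleCrossing_inverse hw'))
  simp only [mul_assoc, one_mul, mul_one] at A B C ⊢
  exact A.trans (B.trans C)

end Slides

lemma Far.singleton {n i k : ℕ} (hi : IsColor n i) (hk : IsColor n k) (d : Distant i k) :
    Far n [i] [k] :=
  ⟨by simpa using hi, by simpa using hk, by simpa using d⟩

lemma shuffleCrossing_one_one (i k : ℕ) :
    shuffleCrossing [i] [k] = slice [] (.cross i k) [] := by
  simp [shuffleCrossing, crossStrand]

lemma shuffleCrossing_two_one (i j k : ℕ) :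
    shuffleCrossing [i, j] [k] = slice [i] (.cross j k) [] * slice [] (.cross i k) [j] := by
  simp [shuffleCrossing, crossStrand]

lemma shuffleCrossing_three_one (i j l k : ℕ) :
    shuffleCrossing [i, j, l] [k] =
      slice [i, j] (.cross l k) [] * slice [i] (.cross j k) [l] * slice [] (.cross i k) [j, l] := by
  simp [shuffleCrossing, crossStrand]

lemma box_X (l : ℕ) : box (MvPolynomial.X l) = slice [] (.box l) [] := by
  have e : (MvPolynomial.X l : MvPolynomial ℕ ℂ) =
      MvPolynomial.basisMonomials ℕ ℂ (Finsupp.single l 1) := by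
    simp [MvPolynomial.X]
  rw [box, e, Module.Basis.constr_basis, monomialBox]
  simp

lemma IsDiagram.valid {n : ℕ} {d : List Slice} {w w' : List ℕ} (hd : IsDiagram n d w w') :
    ∀ s ∈ d, s.gen.Valid n := by
  induction d generalizing w with
  | nil => simp
  | cons t d ih =>
    intro s hs
    rcases List.mem_cons.1 hs with rfl | hs
    exacts [hd.1, ih hd.2.2 s hs]

lemma Gen.Valid.isColor {n : ℕ} {g : Gen} (h : g.Valid n) :
    (∀ i ∈ g.dom, IsColor n i) ∧ ∀ i ∈ g.cod, IsColor n i := by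
  cases g <;> simp only [Gen.Valid] at h <;> simp [Gen.dom, Gen.cod, h]

namespace Slides

section Strand

variable {n i j k : ℕ}

lemma merge (hi : IsColor n i) (hk : IsColor n k) (d : Distant i k) :
    Slides n [i, i] [i] (slice [] (.merge i) []) [k] := by
  simpa [Slides, shuffleCrossing_one_one, shuffleCrossing_two_one] using rel_cross_merge hi hk d

lemma enddot (hi : IsColor n i) (hk : IsColor n k) (d : Distant i k) :
    Slides n [i] [] (slice [] (.enddot i) []) [k] := by
  simpa [Slides, shuffleCrossing_one_one, show shuffleCrossing [] [k] = 1 from rfl] using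
    (rel_cross_enddot hi hk d).symm

lemma six (hi : IsColor n i) (hj : IsColor n j) (hk : IsColor n k) (hij : Adjacent i j)
    (dik : Distant i k) (djk : Distant j k) :
    Slides n [i, j, i] [j, i, j] (slice [] (.six i j) []) [k] := by
  have V : (Gen.six i j).Valid n := ⟨hi, hj, hij⟩
  have X := cross_mem hi hk dik
  have Y := cross_mem hj hk djk
  have R : Rel n [i, j, i, k] [k, j, i, j] _ _ := .of_basic
    (mul_mem_linDiag (mul_mem_linDiag (mul_mem_linDiag (slice_mem V [] [k] :) (Y [j, i] []))
      (X [j] [j])) (Y [] [i, j]))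
    (mul_mem_linDiag (mul_mem_linDiag (mul_mem_linDiag (X [i, j] []) (Y [i] [i])) (X [] [j, i]))
      (slice_mem V [k] [] :)) (.parabolic_A1A2 hi hj hk hij dik djk)
  simpa [Slides, shuffleCrossing_three_one, mul_assoc] using R

lemma cross (hi : IsColor n i) (hj : IsColor n j) (hk : IsColor n k) (hij : Distant i j)
    (dik : Distant i k) (djk : Distant j k) :
    Slides n [i, j] [j, i] (slice [] (.cross i j) []) [k] := by
  have Z := cross_mem hi hj hij
  have X := cross_mem hi hk dik
  have Y := cross_mem hj hk djk
  have R : Rel n [i, j, k] [k, j, i] _ _ := .of_basic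
    (mul_mem_linDiag (mul_mem_linDiag (Z [] [k]) (X [j] [])) (Y [] [i]))
    (mul_mem_linDiag (mul_mem_linDiag (Y [i] []) (X [] [j])) (Z [k] []))
    (.parabolic_A1A1A1 hi hj hk hij dik djk)
  simpa [Slides, shuffleCrossing_two_one, mul_assoc] using R

/-- Polynomial forcing for a variable that is fixed by the simple transposition. -/
lemma box {l : ℕ} (hl : IsVar n l) (hk : IsColor n k) (h : l ≠ k ∧ l ≠ k + 1) :
    Slides n [] [] (slice [] (.box l) []) [k] := by
  have V : (Gen.box l).Valid n := hl
  have s : simpleRefl k (MvPolynomial.X l) = MvPolynomial.X l := by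
    simp [simpleRefl, Equiv.swap_apply_of_ne_of_ne h.1 h.2]
  have B := Basic.polyForce (n := n) hk (p := MvPolynomial.X l) (q := 0)
    (by
      rw [IsPoly, MvPolynomial.mem_supported]
      simpa using hl)
    (by rw [IsPoly]; exact zero_mem _) (by simp [IsDemazure, s])
  simp only [s, map_zero, mul_zero, add_zero, box_X, whisker_slice, List.append_nil,
    List.nil_append] at B
  have R : Rel n [k] [k] _ _ := .of_basic (slice_mem V [] [k] :) (slice_mem V [k] [] :) B
  simpa [Slides, shuffleCrossing] using R

/-- No relation says this directly: rotating a crossing turns it into the statement that two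
crossings of the strands `i` and `k` cancel. -/
lemma cup (hi : IsColor n i) (hk : IsColor n k) (d : Distant i k) :
    Slides n [] [i, i] (cup i) [k] := by
  have X := cross_mem hi hk d
  have Y := cross_mem hk hi d.symm
  have c := (whisker_right_mem [k] (cup_mem hi) :)
  have c' := (whisker_left_mem [k] (cup_mem hi) :)
  -- rotate the first crossing, slide the lower cup to the top and apply the snake relation
  have A := Rel.mul_left c
    (((rel_cross_rotate_left hk hi d.symm).symm.whisker_left [i]).mul_right (X [] [i]))
  have B := (rel_interchange (cup_mem hi) (mul_mem_linDiag c' (Y [] [i]))).mul_right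
    (mul_mem_linDiag (by simpa using whisker_mem_linDiag [i] [k, i] (cap_mem hi)) (X [] [i]))
  have C := Rel.mul_left c' (Rel.mul_left (Y [] [i])
    (((rel_snake_left hi).whisker_right [k, i]).mul_right (X [] [i])))
  have D := Rel.mul_left c' ((rel_cross_cross hk hi d.symm).whisker_right [i])
  simp only [map_mul, whisker_slice, whisker_whisker, mul_assoc, List.append_nil, Slides,
    List.nil_append, List.cons_append, map_one, one_mul, mul_one,
    shuffleCrossing_two_one] at A B C D ⊢
  rw [shuffleCrossing, one_mul]
  exact A.trans (B.trans (C.trans D))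

/-- A startdot is a cup followed by an enddot. -/
lemma startdot (hi : IsColor n i) (hk : IsColor n k) (d : Distant i k) :
    Slides n [] [i] (slice [] (.startdot i) []) [k] := by
  have f := Far.singleton hi hk d
  have f0 : Far n [] [k] := ⟨by simp, f.2, by simp⟩
  have t := slice_mem (g := .startdot i) hi [] []
  have s := slice_mem (g := .split i) hi [] []
  have e := slice_mem (g := .enddot i) hi [] []
  have R : Rel n [i] [i] _ _ := .of_basic
    (mul_mem_linDiag s (slice_mem (g := .enddot i) hi [] [i])) (one_mem_linDiag n rfl)
    (.counit_left hi)
  have E := (enddot hi hk d).whisker e (a := []) (b := [i]) f0 f f0 f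
  have e' : slice [] (.enddot i) [i] ∈ linDiag n [i, i] [i] :=
    slice_mem (g := .enddot i) hi [] [i]
  rw [whisker_slice] at E
  have M := (cup hi hk d).mul E (cup_mem hi) e'
  refine M.congr f0 f ?_
  have Q := Rel.mul_left t R
  simpa [SoergelDiagrammatics.cup, mul_assoc, Gen.dom] using Q

/-- A split is a cup followed by a merge. -/
lemma split (hi : IsColor n i) (hk : IsColor n k) (d : Distant i k) :
    Slides n [i] [i, i] (slice [] (.split i) []) [k] := by
  have f := Far.singleton hi hk d
  have f0 : Far n [] [k] := ⟨by simp, f.2, by simp⟩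
  have f2 : Far n [i, i] [k] := Far.cons_left_iff.2 ⟨f, f⟩
  have m := slice_mem (g := .merge i) hi [] []
  have C := (cup hi hk d).whisker (cup_mem hi) (a := []) (b := [i]) f0 f f2 f0
  have E := (merge hi hk d).whisker m (a := [i]) (b := []) f f0 f f2
  have m' : slice [i] (.merge i) [] ∈ linDiag n [i, i, i] [i, i] :=
    slice_mem (g := .merge i) hi [i] []
  rw [whisker_slice] at E
  exact (C.mul E (whisker_right_mem [i] (cup_mem hi) :) m').congr f f2 (rel_cup_merge hi)

end Strand

end Slides

/-- The strands `v` can be moved through the generating morphism `g` of `D_n`: their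
colors are distant from those of `g`, and if `g` is a box, then its variable is fixed by the simple
transpositions of these colors. -/
structure Gen.Far (n : ℕ) (g : Gen) (v : List ℕ) : Prop where
  valid : g.Valid n
  dom : SoergelDiagrammatics.Far n g.dom v
  cod : SoergelDiagrammatics.Far n g.cod v
  box : ∀ l, g = .box l → ∀ j ∈ v, l ≠ j ∧ l ≠ j + 1

lemma Slides.gen_strand {n k : ℕ} {g : Gen} (h : g.Far n [k]) :
    Slides n g.dom g.cod (slice [] g []) [k] := by
  have hk := h.dom.2 k (by simp)
  have V := h.valid
  have D := h.dom.3
  have C := h.cod.3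
  cases g with
  | merge i => exact .merge V hk (D i (by simp [Gen.dom]) k (by simp))
  | split i => exact .split V hk (D i (by simp [Gen.dom]) k (by simp))
  | startdot i => exact .startdot V hk (C i (by simp [Gen.cod]) k (by simp))
  | enddot i => exact .enddot V hk (D i (by simp [Gen.dom]) k (by simp))
  | six i j =>
    exact .six V.1 V.2.1 hk V.2.2 (D i (by simp [Gen.dom]) k (by simp))
      (D j (by simp [Gen.dom]) k (by simp))
  | cross i j =>
    exact .cross V.1 V.2.1 hk V.2.2 (D i (by simp [Gen.dom]) k (by simp))
      (D j (by simp [Gen.dom]) k (by simp))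
  | box l => exact .box V hk (h.box l rfl k (by simp))

lemma Slides.gen {n : ℕ} {g : Gen} {v : List ℕ} (h : g.Far n v) :
    Slides n g.dom g.cod (slice [] g []) v := by
  have m : slice [] g [] ∈ linDiag n g.dom g.cod := by simpa using slice_mem h.valid [] []
  induction v with
  | nil => exact .nil m
  | cons k v ih =>
    obtain ⟨d, d'⟩ := Far.cons_right_iff.1 h.dom
    obtain ⟨c, c'⟩ := Far.cons_right_iff.1 h.cod
    exact (Slides.gen_strand ⟨h.valid, d, c, fun l e j hj => h.box l e j (by simp_all)⟩).append
      (ih ⟨h.valid, d', c', fun l e j hj => h.box l e j (by simp [hj])⟩) m d c d' c'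

lemma Slides.diagram {n : ℕ} {v : List ℕ} {d : List Slice} {w w' : List ℕ}
    (hd : IsDiagram n d w w') (hw : Far n w v) (h : ∀ s ∈ d, s.gen.Far n v) :
    Slides n w w' (diag d) v ∧ Far n w' v := by
  induction d generalizing w with
  | nil =>
    cases hd
    exact ⟨by rw [diag_nil]; exact .one hw, hw⟩
  | cons s d ih =>
    obtain ⟨hs, rfl, hd⟩ := hd
    have g := h s (by simp)
    obtain ⟨h1, hr⟩ := Far.append_left_iff.1 hw
    obtain ⟨hl, -⟩ := Far.append_left_iff.1 h1
    have hc : Far n s.cod v := Far.append_left_iff.2 ⟨Far.append_left_iff.2 ⟨hl, g.cod⟩, hr⟩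
    obtain ⟨h2, h3⟩ := ih hd hc fun s hs => h s (by simp [hs])
    refine ⟨?_, h3⟩
    have m : slice [] s.gen [] ∈ linDiag n s.gen.dom s.gen.cod := by
      simpa using slice_mem hs [] []
    have S := (Slides.gen g).whisker m hl hr g.cod g.dom
    rw [whisker_slice, List.append_nil, List.nil_append] at S
    have := S.mul h2 (slice_mem hs _ _) (Submodule.subset_span ⟨d, hd, rfl⟩)
    rwa [slice, ← diag_append] at this

/-- Strands of colors less than `a` or greater than `a + n` slide through the diagrams of `D_n`
shifted by `a`. -/
lemma Slides.shift {a n N : ℕ} (hN : a + n ≤ N) {w w' v : List ℕ} {x : DiagAlg}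
    (hx : x ∈ linDiag n w w') (hw : ∀ i ∈ w, IsColor n i)
    (hv : ∀ j ∈ v, IsColor N j ∧ (j + 1 ≤ a ∨ a + n < j)) :
    Slides N (w.map (a + ·)) (w'.map (a + ·)) (shift a x) v := by
  have far : ∀ u : List ℕ, (∀ i ∈ u, IsColor n i) → Far N (u.map (a + ·)) v := by
    intro u hu
    refine ⟨fun i hi => ?_, fun j hj => (hv j hj).1, fun i hi j hj => ?_⟩ <;>
      obtain ⟨k, hk, rfl⟩ := List.mem_map.1 hi
    · exact (hu k hk).shift hN
    · have h1 := hu k hk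
      have h2 := hv j hj
      simp only [IsColor, Distant] at *
      omega
  induction hx using Submodule.span_induction with
  | mem x hx =>
    obtain ⟨d, hd, rfl⟩ := hx
    rw [shift_diag]
    refine (Slides.diagram (isDiagram_shift hN hd) (far w hw) fun t ht => ?_).1
    obtain ⟨s, hs, rfl⟩ := List.mem_map.1 ht
    have V := hd.valid s hs
    refine ⟨Gen.shift_valid hN V, ?_, ?_, ?_⟩
    · rw [Gen.shift_dom]
      exact far _ V.isColor.1
    · rw [Gen.shift_cod]
      exact far _ V.isColor.2
    · intro l hl j hj
      cases e : s.gen <;> rw [e] at hl V <;> cases hl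
      have := hv j hj
      simp only [Gen.Valid, IsVar] at V
      omega
  | zero => simpa [Slides] using Rel.refl (zero_mem _)
  | add x y _ _ hx hy => rw [map_add]; exact hx.add hy
  | smul c x _ hx => rw [map_smul]; exact hx.smul c

/-! ### Homogeneous components of diagrams -/

lemma diagAlg_linearMap_ext {M : Type*} [AddCommGroup M] [Module ℂ M] {φ ψ : DiagAlg →ₗ[ℂ] M}
    (h : ∀ d, φ (diag d) = ψ (diag d)) : φ = ψ :=
  (MonoidAlgebra.basis (FreeMonoid Slice) ℂ).ext fun d => by
    simpa [diag] using h (FreeMonoid.toList d)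

/-- The projection of linear combinations of sequences of slices to those of degree `k`. -/
def degreePart (k : ℤ) : DiagAlg →ₗ[ℂ] DiagAlg :=
  (MonoidAlgebra.basis (FreeMonoid Slice) ℂ).constr ℂ fun d =>
    if degree (FreeMonoid.toList d) = k then diag (FreeMonoid.toList d) else 0

lemma degreePart_diag (k : ℤ) (d : List Slice) :
    degreePart k (diag d) = if degree d = k then diag d else 0 := by
  have e : diag d = MonoidAlgebra.basis (FreeMonoid Slice) ℂ (FreeMonoid.ofList d) := by
    simp [diag]
  rw [e, degreePart, Module.Basis.constr_basis]
  simp [diag]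

/-- Linear combinations of sequences of slices of degree `k`. -/
def homog (k : ℤ) : Submodule ℂ DiagAlg :=
  Submodule.span ℂ {x | ∃ d : List Slice, degree d = k ∧ x = diag d}

lemma degree_append (d d' : List Slice) : degree (d ++ d') = degree d + degree d' := by
  simp [degree]

lemma diag_mem_homog (d : List Slice) : diag d ∈ homog (degree d) :=
  Submodule.subset_span ⟨d, rfl, rfl⟩

lemma homog_one : (1 : DiagAlg) ∈ homog 0 := diag_nil ▸ diag_mem_homog []

lemma homog_slice (u : List ℕ) (g : Gen) (v : List ℕ) : slice u g v ∈ homog g.deg := by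
  have h := diag_mem_homog [⟨u, g, v⟩]
  rwa [degree, List.map_singleton, List.sum_singleton] at h

lemma homog_mul {a b : ℤ} {x y : DiagAlg} (hx : x ∈ homog a) (hy : y ∈ homog b) :
    x * y ∈ homog (a + b) := by
  have h := Submodule.mul_mem_mul hx hy
  rw [homog, homog, Submodule.span_mul_span] at h
  refine Submodule.span_mono ?_ h
  rintro _ ⟨_, ⟨d, rfl, rfl⟩, _, ⟨d', rfl, rfl⟩, rfl⟩
  exact ⟨d ++ d', degree_append d d', (diag_append d d').symm⟩

lemma homog_whisker (u v : List ℕ) {a : ℤ} {x : DiagAlg} (hx : x ∈ homog a) :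
    whisker u v x ∈ homog a := by
  have h := Submodule.mem_map_of_mem (f := (whisker u v).toLinearMap) hx
  rw [homog, Submodule.map_span] at h
  refine Submodule.span_mono ?_ h
  rintro _ ⟨_, ⟨d, rfl, rfl⟩, rfl⟩
  exact ⟨_, by simp [degree, Function.comp_def], whisker_diag u v d⟩

lemma homog_sub {a b : ℤ} {x y : DiagAlg} (hx : x ∈ homog a) (hy : y ∈ homog b) (h : b = a) :
    x - y ∈ homog a :=
  sub_mem hx (h ▸ hy)

lemma homog_add {a b : ℤ} {x y : DiagAlg} (hx : x ∈ homog a) (hy : y ∈ homog b) (h : b = a) :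
    x + y ∈ homog a :=
  add_mem hx (h ▸ hy)

lemma homog_cap (i : ℕ) : cap i ∈ homog 0 :=
  (homog_mul (homog_slice [] (.merge i) []) (homog_slice [] (.enddot i) []) :)

lemma homog_cup (i : ℕ) : cup i ∈ homog 0 :=
  (homog_mul (homog_slice [] (.startdot i) []) (homog_slice [] (.split i) []) :)

lemma homog_box_root (i : ℕ) :
    box (MvPolynomial.X i - MvPolynomial.X (i + 1)) ∈ homog 2 := by
  rw [map_sub, box_X, box_X]
  exact (homog_sub (homog_slice [] (.box i) []) (homog_slice [] (.box (i + 1)) []) rfl :)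

lemma degreePart_of_mem {a : ℤ} (k : ℤ) {x : DiagAlg} (hx : x ∈ homog a) :
    degreePart k x = if a = k then x else 0 := by
  induction hx using Submodule.span_induction with
  | mem x hx =>
    obtain ⟨d, rfl, rfl⟩ := hx
    exact degreePart_diag k d
  | zero => simp
  | add x y _ _ hx hy => rw [map_add, hx, hy]; split_ifs <;> simp
  | smul c x _ hx => rw [map_smul, hx]; split_ifs <;> simp

lemma degreePart_whisker (k : ℤ) (u v : List ℕ) (x : DiagAlg) :
    degreePart k (whisker u v x) = whisker u v (degreePart k x) := by
  refine LinearMap.congr_fun (diagAlg_linearMap_ext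
    (φ := degreePart k ∘ₗ (whisker u v).toLinearMap)
    (ψ := (whisker u v).toLinearMap ∘ₗ degreePart k) fun d => ?_) x
  simp only [LinearMap.comp_apply, AlgHom.toLinearMap_apply]
  rw [degreePart_of_mem k (homog_whisker u v (diag_mem_homog d)), degreePart_diag]
  split_ifs <;> simp

lemma degreePart_mul_of_mem {a : ℤ} (k : ℤ) {x : DiagAlg} (hx : x ∈ homog a) (y : DiagAlg) :
    degreePart k (x * y) = x * degreePart (k - a) y := by
  refine LinearMap.congr_fun (diagAlg_linearMap_ext
    (φ := degreePart k ∘ₗ LinearMap.mulLeft ℂ x)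
    (ψ := LinearMap.mulLeft ℂ x ∘ₗ degreePart (k - a)) fun d => ?_) y
  simp only [LinearMap.comp_apply, LinearMap.mulLeft_apply]
  rw [degreePart_of_mem k (homog_mul hx (diag_mem_homog d)), degreePart_diag]
  have : a + degree d = k ↔ degree d = k - a := by omega
  split_ifs <;> simp_all

lemma degreePart_mul_of_mem_right {a : ℤ} (k : ℤ) {y : DiagAlg} (hy : y ∈ homog a) (x : DiagAlg) :
    degreePart k (x * y) = degreePart (k - a) x * y := by
  refine LinearMap.congr_fun (diagAlg_linearMap_ext
    (φ := degreePart k ∘ₗ LinearMap.mulRight ℂ y)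
    (ψ := LinearMap.mulRight ℂ y ∘ₗ degreePart (k - a)) fun d => ?_) x
  simp only [LinearMap.comp_apply, LinearMap.mulRight_apply]
  rw [degreePart_of_mem k (homog_mul (diag_mem_homog d) hy), degreePart_diag]
  have : degree d + a = k ↔ degree d = k - a := by omega
  split_ifs <;> simp_all

/-- The component of degree `k` of a polynomial, where all variables have degree `2`. -/
abbrev polyPart (k : ℤ) : MvPolynomial ℕ ℂ →ₗ[ℂ] MvPolynomial ℕ ℂ :=
  MvPolynomial.weightedHomogeneousComponent (fun _ => (2 : ℤ)) k

lemma polyPart_monomial (k : ℤ) (m : ℕ →₀ ℕ) (c : ℂ) :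
    polyPart k (MvPolynomial.monomial m c) =
      if k = Finsupp.weight (fun _ => (2 : ℤ)) m then MvPolynomial.monomial m c else 0 :=
  MvPolynomial.weightedHomogeneousComponent_of_mem
    (MvPolynomial.isWeightedHomogeneous_monomial _ m c rfl)

lemma homog_monomialBox (m : ℕ →₀ ℕ) :
    monomialBox m ∈ homog (Finsupp.weight (fun _ => (2 : ℤ)) m) := by
  have key : ∀ l : List ℕ, (l.map fun k => slice [] (.box k) []).prod ∈ homog (2 * l.length) := by
    intro l
    induction l with
    | nil => exact homog_one
    | cons a l ih =>
      have := homog_mul (homog_slice [] (.box a) []) ih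
      simpa [Gen.deg, mul_add, add_comm] using this
  have := key (Finsupp.toMultiset m).sort
  rw [Multiset.length_sort, Finsupp.card_toMultiset] at this
  convert this using 2
  · simp [Finsupp.weight_apply, Finsupp.sum, Finset.mul_sum, mul_comm]
  · rfl

lemma degreePart_box (k : ℤ) (p : MvPolynomial ℕ ℂ) :
    degreePart k (box p) = box (polyPart k p) := by
  refine LinearMap.congr_fun (f := degreePart k ∘ₗ box) (g := box ∘ₗ polyPart k)
    ((MvPolynomial.basisMonomials ℕ ℂ).ext fun m => ?_) p
  have e : box (MvPolynomial.monomial m 1) = monomialBox m :=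
    (MvPolynomial.basisMonomials ℕ ℂ).constr_basis ℂ monomialBox m
  simp only [LinearMap.comp_apply, MvPolynomial.coe_basisMonomials, polyPart_monomial, e]
  rw [degreePart_of_mem k (homog_monomialBox m)]
  simp only [@eq_comm ℤ k]
  split_ifs <;> simp [e]

lemma polyPart_simpleRefl (k : ℤ) (i : ℕ) (p : MvPolynomial ℕ ℂ) :
    polyPart k (simpleRefl i p) = simpleRefl i (polyPart k p) := by
  induction p using MvPolynomial.induction_on' with
  | monomial m c =>
    rw [simpleRefl, MvPolynomial.rename_monomial, polyPart_monomial, polyPart_monomial]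
    have : Finsupp.weight (fun _ => (2 : ℤ)) (m.mapDomain (Equiv.swap i (i + 1))) =
        Finsupp.weight (fun _ => (2 : ℤ)) m := by
      simp [Finsupp.weight_apply, Finsupp.sum_mapDomain_index, add_mul]
    rw [this]
    split_ifs <;> simp [MvPolynomial.rename_monomial]
  | add p q hp hq => simp only [map_add, hp, hq]

lemma polyPart_mul {l : MvPolynomial ℕ ℂ} {a : ℤ}
    (hl : MvPolynomial.IsWeightedHomogeneous (fun _ => (2 : ℤ)) l a) (k : ℤ)
    (q : MvPolynomial ℕ ℂ) : polyPart k (l * q) = l * polyPart (k - a) q := by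
  induction q using MvPolynomial.induction_on' with
  | monomial m c =>
    rw [polyPart_monomial, polyPart, MvPolynomial.weightedHomogeneousComponent_of_mem
      (hl.mul (MvPolynomial.isWeightedHomogeneous_monomial _ m c rfl))]
    have : k = a + Finsupp.weight (fun _ => (2 : ℤ)) m ↔
      k - a = Finsupp.weight (fun _ => (2 : ℤ)) m := by omega
    split_ifs <;> simp_all
  | add p q hp hq => simp only [mul_add, map_add, hp, hq]

lemma IsPoly.polyPart {n : ℕ} {p : MvPolynomial ℕ ℂ} (hp : IsPoly n p) (k : ℤ) :
    IsPoly n (polyPart k p) := by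
  rw [IsPoly, MvPolynomial.mem_supported] at *
  refine subset_trans ?_ hp
  intro i hi
  simp only [Finset.mem_coe, MvPolynomial.mem_vars_iff_mem_support,
    MvPolynomial.support_weightedHomogeneousComponent,
    Finset.mem_filter] at hi ⊢
  obtain ⟨m, hm, hi⟩ := hi
  exact ⟨m, hm.1, hi⟩

/-- Demazure operators lower the degree of polynomials by `2`. -/
lemma IsDemazure.polyPart {i : ℕ} {p q : MvPolynomial ℕ ℂ} (h : IsDemazure i p q) (k : ℤ) :
    IsDemazure i (polyPart k p) (polyPart (k - 2) q) := by
  rw [IsDemazure] at *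
  rw [← polyPart_mul (sub_mem (MvPolynomial.isWeightedHomogeneous_X ℂ _ i)
    (MvPolynomial.isWeightedHomogeneous_X ℂ _ (i + 1)) :
      _ ∈ MvPolynomial.weightedHomogeneousSubmodule ℂ _ (2 : ℤ)), h, map_sub, polyPart_simpleRefl]

/-! ### The tensor ideal is homogeneous -/

lemma InIdeal.degreePart_of_mem {n : ℕ} {w w' : List ℕ} {r : DiagAlg} (h : InIdeal n w w' r)
    (hr : ∃ a, r ∈ homog a) (k : ℤ) : InIdeal n w w' (degreePart k r) := by
  obtain ⟨a, hr⟩ := hr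
  rw [SoergelDiagrammatics.degreePart_of_mem k hr]
  split_ifs
  exacts [h, .zero w w']

/-- The interchange relators are bilinear, and homogeneous if both arguments are diagrams. -/
lemma interchange_degreePart {n : ℕ} {w w' v v' : List ℕ} {f g : DiagAlg}
    (hf : f ∈ linDiag n w w') (hg : g ∈ linDiag n v v') (k : ℤ) :
    InIdeal n (w ++ v) (w' ++ v') (degreePart k
      (whisker [] v f * whisker w' [] g - whisker w [] g * whisker [] v' f)) := by
  induction hf using Submodule.span_induction with
  | mem f hf =>
    obtain ⟨d, hd, rfl⟩ := hf
    induction hg using Submodule.span_induction with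
    | mem g hg =>
      obtain ⟨d', hd', rfl⟩ := hg
      exact InIdeal.degreePart_of_mem (.basic (.interchange (Submodule.subset_span ⟨d, hd, rfl⟩)
        (Submodule.subset_span ⟨d', hd', rfl⟩)))
        ⟨_, homog_sub (homog_mul (homog_whisker _ _ (diag_mem_homog d))
          (homog_whisker _ _ (diag_mem_homog d'))) (homog_mul
          (homog_whisker _ _ (diag_mem_homog d')) (homog_whisker _ _ (diag_mem_homog d)))
          (add_comm _ _)⟩ k
    | zero => simpa using InIdeal.zero _ _
    | add x y _ _ hx hy =>
      have := hx.add hy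
      rw [← map_add] at this
      convert this using 2
      simp only [map_add, mul_add, add_mul]
      abel
    | smul c x _ hx =>
      have := hx.smul c
      rw [← map_smul] at this
      convert this using 2
      simp [smul_sub]
  | zero => simpa using InIdeal.zero _ _
  | add x y _ _ hx hy =>
    have := hx.add hy
    rw [← map_add] at this
    convert this using 2
    simp only [map_add, mul_add, add_mul]
    abel
  | smul c x _ hx =>
    have := hx.smul c
    rw [← map_smul] at this
    convert this using 2
    simp [smul_sub]

/-- The components of a polynomial forcing relator are the relators of the components of `p`. -/
lemma polyForce_degreePart {n i : ℕ} (hi : IsColor n i) {p q : MvPolynomial ℕ ℂ}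
    (hp : IsPoly n p) (hq : IsPoly n q) (hpq : IsDemazure i p q) (k : ℤ) :
    InIdeal n [i] [i] (degreePart k (whisker [] [i] (box p)
      - (whisker [i] [] (box (simpleRefl i p))
        + slice [] (.enddot i) [] * slice [] (.startdot i) [] * whisker [i] [] (box q)))) := by
  have h : slice [] (.enddot i) [] * slice [] (.startdot i) [] ∈ homog 2 :=
    (homog_mul (homog_slice [] (.enddot i) []) (homog_slice [] (.startdot i) []) :)
  simp only [map_sub, map_add, degreePart_mul_of_mem k h, degreePart_whisker, degreePart_box,
    polyPart_simpleRefl]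
  exact .basic (.polyForce hi (hp.polyPart k) (hq.polyPart (k - 2)) (hpq.polyPart k))

lemma Basic.degreePart {n : ℕ} {w w' : List ℕ} {r : DiagAlg} (h : Basic n w w' r) (k : ℤ) :
    InIdeal n w w' (degreePart k r) := by
  have h' := h
  cases h' with
  | interchange hf hg => exact interchange_degreePart hf hg k
  | polyForce hi hp hq hpq => exact polyForce_degreePart hi hp hq hpq k
  | _ =>
    refine InIdeal.degreePart_of_mem (.basic h) ?_ k
    apply Exists.intro
    repeat' first
      | with_reducible exact homog_one
      | with_reducible exact homog_slice _ _ _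
      | with_reducible exact homog_cap _
      | with_reducible exact homog_cup _
      | with_reducible exact homog_box_root _
      | with_reducible apply homog_whisker
      | with_reducible apply homog_mul
      | with_reducible apply homog_sub
      | with_reducible apply homog_add
    all_goals rfl

/-- The tensor ideal is spanned by homogeneous elements. -/
lemma InIdeal.degreePart {n : ℕ} {w w' : List ℕ} {r : DiagAlg} (h : InIdeal n w w' r) :
    ∀ k, InIdeal n w w' (degreePart k r) := by
  induction h with
  | basic h => exact h.degreePart
  | zero w w' => intro k; simpa using InIdeal.zero w w'
  | add _ _ hr hs => intro k; simpa using (hr k).add (hs k)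
  | smul c _ hr => intro k; simpa using (hr k).smul c
  | comp_left hp _ ih =>
    intro k
    induction hp using Submodule.span_induction with
    | mem p hp =>
      obtain ⟨d, hd, rfl⟩ := hp
      rw [degreePart_mul_of_mem k (diag_mem_homog d)]
      exact .comp_left (Submodule.subset_span ⟨d, hd, rfl⟩) (ih _)
    | zero => simpa using InIdeal.zero _ _
    | add x y _ _ hx hy => simpa [add_mul] using hx.add hy
    | smul c x _ hx => simpa using hx.smul c
  | comp_right _ hp ih =>
    intro k
    induction hp using Submodule.span_induction with
    | mem p hp =>
      obtain ⟨d, hd, rfl⟩ := hp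
      rw [degreePart_mul_of_mem_right k (diag_mem_homog d)]
      exact .comp_right (ih _) (Submodule.subset_span ⟨d, hd, rfl⟩)
    | zero => simpa using InIdeal.zero _ _
    | add x y _ _ hx hy => simpa [mul_add] using hx.add hy
    | smul c x _ hx => simpa using hx.smul c
  | whisker u v _ ih =>
    intro k
    rw [degreePart_whisker]
    exact (ih k).whisker u v

/-! ### The grading of the morphism spaces -/

section Degree

variable {n : ℕ} {u v w w' : List ℕ} {k l : ℤ} {x y : DiagAlg}

lemma linDiagDeg_le_linDiag (n : ℕ) (w w' : List ℕ) (k : ℤ) :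
    linDiagDeg n w w' k ≤ linDiag n w w' :=
  Submodule.span_mono fun _ ⟨d, hd, _, e⟩ => ⟨d, hd, e⟩

lemma linDiagDeg_le_homog (n : ℕ) (w w' : List ℕ) (k : ℤ) : linDiagDeg n w w' k ≤ homog k :=
  Submodule.span_mono fun _ ⟨d, _, h, e⟩ => ⟨d, h, e⟩

lemma degreePart_mem (k : ℤ) (hx : x ∈ linDiag n w w') :
    degreePart k x ∈ linDiagDeg n w w' k := by
  induction hx using Submodule.span_induction with
  | mem x hx =>
    obtain ⟨d, hd, rfl⟩ := hx
    rw [degreePart_diag]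
    split_ifs with h
    exacts [Submodule.subset_span ⟨d, hd, h, rfl⟩, zero_mem _]
  | zero => rw [map_zero]; exact zero_mem _
  | add x y _ _ hx hy => rw [map_add]; exact add_mem hx hy
  | smul c x _ hx => rw [map_smul]; exact Submodule.smul_mem _ c hx

/-- Homogeneous linear combinations of diagrams. -/
lemma mem_linDiagDeg (hx : x ∈ linDiag n w w') (h : x ∈ homog k) : x ∈ linDiagDeg n w w' k := by
  have := degreePart_mem k hx
  rwa [degreePart_of_mem k h, if_pos rfl] at this

lemma homog_shift (a : ℕ) (hx : x ∈ homog k) : shift a x ∈ homog k := by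
  have h := Submodule.mem_map_of_mem (f := (shift a).toLinearMap) hx
  rw [homog, Submodule.map_span] at h
  refine Submodule.span_mono ?_ h
  rintro _ ⟨_, ⟨d, rfl, rfl⟩, rfl⟩
  refine ⟨_, ?_, shift_diag a d⟩
  have (g : Gen) : (g.shift a).deg = g.deg := by cases g <;> rfl
  simp [degree, Function.comp_def, this]

lemma homog_mul_zero (hx : x ∈ homog 0) (hy : y ∈ homog 0) : x * y ∈ homog 0 :=
  (homog_mul hx hy :)

lemma homog_crossStrand (i : ℕ) (v : List ℕ) : crossStrand i v ∈ homog 0 := by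
  induction v with
  | nil => exact homog_one
  | cons j v ih => exact homog_mul_zero (homog_slice [] (.cross i j) v) (homog_whisker [j] [] ih)

lemma homog_shuffleCrossing (u v : List ℕ) : shuffleCrossing u v ∈ homog 0 := by
  induction u with
  | nil => exact homog_one
  | cons i u ih =>
    exact homog_mul_zero (homog_whisker [i] [] ih) (homog_whisker [] u (homog_crossStrand i v))

end Degree

namespace HomSpace

variable {n : ℕ} {w w' : List ℕ} {k l : ℤ}

lemma mk_mem_piece {x : DiagAlg} (hx : x ∈ linDiag n w w') (h : x ∈ homog k) :
    mk x hx ∈ piece w w' k :=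
  Submodule.mem_map.2 ⟨⟨x, hx⟩, mem_linDiagDeg hx h, rfl⟩

lemma exists_of_mem_piece {α : HomSpace n w w'} (h : α ∈ piece w w' k) :
    ∃ x, ∃ hx : x ∈ linDiag n w w', x ∈ homog k ∧ α = mk x hx := by
  obtain ⟨⟨x, hx⟩, hd, rfl⟩ := Submodule.mem_map.1 h
  exact ⟨x, hx, linDiagDeg_le_homog n w w' k hd, rfl⟩

/-- The component of degree `k` of a morphism. -/
def degreePart (k : ℤ) : HomSpace n w w' →ₗ[ℂ] HomSpace n w w' :=
  Submodule.mapQ _ _ ((SoergelDiagrammatics.degreePart k).restrict fun _ hx =>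
    linDiagDeg_le_linDiag n w w' k (degreePart_mem k hx)) fun _ hx => InIdeal.degreePart hx k

lemma degreePart_of_mem {α : HomSpace n w w'} (h : α ∈ piece w w' l) :
    degreePart k α = if l = k then α else 0 := by
  obtain ⟨x, hx, hd, rfl⟩ := exists_of_mem_piece h
  have e := SoergelDiagrammatics.degreePart_of_mem k hd
  split_ifs at e ⊢ with hk
  · exact mk_congr e
  · exact mk_congr (hy := zero_mem _) e

/-- The morphism spaces of `D_n` are graded, because the tensor ideal is homogeneous. -/
lemma isInternal : DirectSum.IsInternal (piece w w' : ℤ → Submodule ℂ (HomSpace n w w')) := by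
  rw [DirectSum.isInternal_submodule_iff_iSupIndep_and_iSup_eq_top]
  constructor
  · intro k
    rw [Submodule.disjoint_def]
    intro α h1 h2
    have h3 : (⨆ (j) (_ : j ≠ k), piece w w' j) ≤ LinearMap.ker (degreePart (n := n) k) := by
      refine iSup₂_le fun j hj α hα => ?_
      rw [LinearMap.mem_ker, degreePart_of_mem hα, if_neg hj]
    have h4 : degreePart k α = 0 := h3 h2
    rwa [degreePart_of_mem h1, if_pos rfl] at h4
  · rw [eq_top_iff]
    rintro α -
    induction α using HomSpace.ind with | h x hx =>
    induction hx using Submodule.span_induction with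
    | mem x hx =>
      obtain ⟨d, hd, rfl⟩ := hx
      exact Submodule.mem_iSup_of_mem (degree d) (mk_mem_piece _ (diag_mem_homog d))
    | zero => exact zero_mem _
    | add x y hx hy hx' hy' => exact add_mem hx' hy'
    | smul c x hx hx' => exact Submodule.smul_mem _ c hx'

/-- Classes of related linear combinations of diagrams, in morphism spaces which are equal up to
rewriting of the rank and the words. -/
lemma heq_mk {n' : ℕ} {v v' : List ℕ} {x y : DiagAlg} {hx : x ∈ linDiag n w w'}
    {hy : y ∈ linDiag n' v v'} (hn : n = n') (hw : w = v) (hw' : w' = v')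
    (h : InIdeal n w w' (x - y)) : HEq (mk x hx) (mk y hy) := by
  subst hn hw hw'
  exact heq_of_eq (mk_eq_mk.2 h)

lemma heq_mk_of_eq {n' : ℕ} {v v' : List ℕ} {x y : DiagAlg} {hx : x ∈ linDiag n w w'}
    {hy : y ∈ linDiag n' v v'} (hn : n = n') (hw : w = v) (hw' : w' = v') (h : x = y) :
    HEq (mk x hx) (mk y hy) := by
  subst h
  exact heq_mk hn hw hw' (by rw [sub_self]; exact .zero _ _)

end HomSpace

lemma OneHom.heq {m n m' n' : Obj} {f : m ⟶ n} {g : m' ⟶ n'} (hm : m = m') (hn : n = n')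
    (h : f.word = g.word) : HEq f g := by
  subst hm hn
  exact heq_of_eq (OneHom.ext h)

/-! ### Color shifting -/

lemma Gen.shift_shift (a b : ℕ) (g : Gen) : (g.shift b).shift a = g.shift (a + b) := by
  cases g <;> simp [Gen.shift, add_assoc]

lemma Gen.shift_zero (g : Gen) : g.shift 0 = g := by
  cases g <;> simp [Gen.shift]

lemma map_add_map_add (a b : ℕ) (w : List ℕ) :
    (w.map (b + ·)).map (a + ·) = w.map (a + b + ·) := by
  simp [add_assoc, Function.comp_def]

lemma shift_shift (a b : ℕ) (x : DiagAlg) : shift a (shift b x) = shift (a + b) x := by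
  refine diagAlg_hom_ext (φ := (shift a).comp (shift b)) (fun d => ?_) x
  simp [shift_diag, Function.comp_def, Gen.shift_shift, add_assoc]

lemma shift_zero (x : DiagAlg) : shift 0 x = x := by
  refine diagAlg_hom_ext (ψ := AlgHom.id ℂ DiagAlg) (fun d => ?_) x
  simp [shift_diag, Gen.shift_zero]

lemma shift_crossStrand (a i : ℕ) (v : List ℕ) :
    shift a (crossStrand i v) = crossStrand (a + i) (v.map (a + ·)) := by
  induction v with
  | nil => simp [crossStrand]
  | cons j v ih => simp [crossStrand, ih, shift_whisker, shift_slice, Gen.shift]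

lemma shift_shuffleCrossing (a : ℕ) (u v : List ℕ) :
    shift a (shuffleCrossing u v) = shuffleCrossing (u.map (a + ·)) (v.map (a + ·)) := by
  induction u with
  | nil => simp [shuffleCrossing]
  | cons i u ih => simp [shuffleCrossing, ih, shift_whisker, shift_crossStrand]

/-! ### The 2-category of diagrammatic categories -/

lemma eqToHom_eq_ofEq {m n : Obj} {f g : m ⟶ n} (h : f = g) :
    eqToHom h = (isoOfEq (congrArg OneHom.word h)).hom := by
  subst h
  rfl

lemma eqToIso_eq_isoOfEq {m n : Obj} {f g : m ⟶ n} (h : f = g) (h' : f.word = g.word) :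
    isoOfEq h' = eqToIso h := by
  ext
  rw [eqToIso.hom, eqToHom_eq_ofEq]

instance strict_obj : Bicategory.Strict Obj where
  id_comp f := OneHom.ext (List.append_nil f.word)
  comp_id f := OneHom.ext (List.nil_append f.word)
  assoc f g h := OneHom.ext (List.append_assoc h.word g.word f.word).symm
  leftUnitor_eqToIso _ := eqToIso_eq_isoOfEq _ _
  rightUnitor_eqToIso _ := eqToIso_eq_isoOfEq _ _
  associator_eqToIso _ _ _ := eqToIso_eq_isoOfEq _ _

lemma grading_isLocallyGradedLinear : grading.IsLocallyGradedLinear where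
  isInternal f g := HomSpace.isInternal
  id_mem f := HomSpace.mk_mem_piece _ homog_one
  comp_mem hη hθ := by
    obtain ⟨x, hx, dx, rfl⟩ := HomSpace.exists_of_mem_piece hη
    obtain ⟨y, hy, dy, rfl⟩ := HomSpace.exists_of_mem_piece hθ
    exact HomSpace.mk_mem_piece _ (homog_mul dx dy)
  whiskerLeft_mem f _ _ _ _ hη := by
    obtain ⟨x, hx, dx, rfl⟩ := HomSpace.exists_of_mem_piece hη
    exact HomSpace.mk_mem_piece (mem_linDiag_of_eq (OneHom.rank_eq f)
      (whisker_mem_linDiag [] f.word hx)) (homog_whisker _ _ dx)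
  whiskerRight_mem hη h := by
    obtain ⟨x, hx, dx, rfl⟩ := HomSpace.exists_of_mem_piece hη
    exact HomSpace.mk_mem_piece (whisker_left_mem h.word hx) (homog_whisker _ _ dx)
  whiskerLeft_add f _ _ η θ :=
    map_add (HomSpace.whiskerRight (OneHom.rank_eq f) f.word) η θ
  whiskerLeft_smul f _ _ r η :=
    map_smul (HomSpace.whiskerRight (OneHom.rank_eq f) f.word) r η
  add_whiskerRight η θ h := map_add (HomSpace.whiskerLeft h.word) η θ
  smul_whiskerRight r η h := map_smul (HomSpace.whiskerLeft h.word) r η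

lemma tensorData_isGradedLinear : tensorData.IsGradedLinear grading where
  left₂_add A B _ _ _ β γ := map_add (HomSpace.shift A.rank (A.rank + B.rank) le_rfl) β γ
  left₂_smul A B _ _ _ r β := map_smul (HomSpace.shift A.rank (A.rank + B.rank) le_rfl) r β
  left₂_mem A B _ _ _ _ _ hβ := by
    obtain ⟨x, hx, dx, rfl⟩ := HomSpace.exists_of_mem_piece hβ
    exact HomSpace.mk_mem_piece (shift_mem_linDiag le_rfl hx) (homog_shift _ dx)
  right₂_add {A _ _ _} α γ B :=
    map_add (HomSpace.shift 0 (A.rank + B.rank) (by omega)) α γ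
  right₂_smul {A _ _ _} r α B :=
    map_smul (HomSpace.shift 0 (A.rank + B.rank) (by omega)) r α
  right₂_mem {A _ _ _ _ _} hα B := by
    obtain ⟨x, hx, dx, rfl⟩ := HomSpace.exists_of_mem_piece hα
    exact HomSpace.mk_mem_piece (shift_mem_linDiag
      (show 0 + A.rank ≤ A.rank + B.rank by omega) hx) (homog_shift _ dx)
  tensorator_mem f g := HomSpace.mk_mem_piece _ (homog_shuffleCrossing _ _)

lemma map_zero_add (w : List ℕ) : w.map (0 + ·) = w := by simp

/-- The colors of `D_m` are distant from the colors of `D_n` shifted by `m`. -/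
lemma far_tensor {m n : ℕ} {u v : List ℕ} (hu : ∀ i ∈ u, IsColor m i) (hv : ∀ j ∈ v, IsColor n j) :
    Far (m + n) (u.map (0 + ·)) (v.map (m + ·)) := by
  rw [map_zero_add]
  refine ⟨fun i hi => ?_, fun j hj => ?_, fun i hi j hj => ?_⟩
  · have := hu i hi
    simp only [IsColor] at *
    omega
  · obtain ⟨k, hk, rfl⟩ := List.mem_map.1 hj
    exact (hv k hk).shift le_rfl
  · obtain ⟨k, hk, rfl⟩ := List.mem_map.1 hj
    have h1 := hu i hi
    have h2 := hv k hk
    simp only [IsColor, Distant] at *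
    omega

@[simp]
lemma comp_word {m n k : Obj} (f : m ⟶ n) (g : n ⟶ k) : (f ≫ g).word = g.word ++ f.word := rfl

@[simp]
lemma id_word (n : Obj) : (𝟙 n : n ⟶ n).word = [] := rfl

@[simp]
lemma tensorData_left₁_word (A : Obj) {B B' : Obj} (g : B ⟶ B') :
    (tensorData.left₁ A g).word = g.word.map (A.rank + ·) := rfl

@[simp]
lemma tensorData_right₁_word {A A' : Obj} (f : A ⟶ A') (B : Obj) :
    (tensorData.right₁ f B).word = f.word.map (0 + ·) := rfl

@[simp]
lemma tensorData_obj_rank (A B : Obj) : (tensorData.obj A B).rank = A.rank + B.rank := rfl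

lemma tensorData_isSemistrictMonoidal : tensorData.IsSemistrictMonoidal where
  isIso_tensorator {A A' B B'} f g := by
    obtain rfl := f.eq
    obtain rfl := g.eq
    have F := far_tensor f.isColor g.isColor
    exact ⟨HomSpace.mk _ F.symm.crossing_mem,
      HomSpace.mk_eq_mk.2 (rel_shuffleCrossing_inverse F).3,
      HomSpace.mk_eq_mk.2 (rel_shuffleCrossing_inverse F.symm).3⟩
  left_twoFunctor A :=
    { map₁_id := fun B => OneHom.ext rfl
      map₁_comp := fun f g => OneHom.ext List.map_append
      map₂_id := fun f => HomSpace.mk_congr (map_one (shift A.rank))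
      map₂_comp := fun η θ => by
        induction η using HomSpace.ind with | h x hx =>
        induction θ using HomSpace.ind with | h y hy =>
        exact HomSpace.mk_congr (map_mul (shift A.rank) x y)
      map₂_whiskerLeft := fun f _ _ η => by
        induction η using HomSpace.ind with | h x hx =>
        exact HomSpace.heq_mk_of_eq rfl List.map_append List.map_append
          (shift_whisker A.rank [] f.word x)
      map₂_whiskerRight := fun η h => by
        induction η using HomSpace.ind with | h x hx =>
        exact HomSpace.heq_mk_of_eq rfl List.map_append List.map_append
          (shift_whisker A.rank h.word [] x) }
  right_twoFunctor B :=
    { map₁_id := fun A => OneHom.ext rfl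
      map₁_comp := fun f g => OneHom.ext List.map_append
      map₂_id := fun f => HomSpace.mk_congr (map_one (shift 0))
      map₂_comp := fun η θ => by
        induction η using HomSpace.ind with | h x hx =>
        induction θ using HomSpace.ind with | h y hy =>
        exact HomSpace.mk_congr (map_mul (shift 0) x y)
      map₂_whiskerLeft := fun f _ _ η => by
        induction η using HomSpace.ind with | h x hx =>
        exact HomSpace.heq_mk_of_eq rfl List.map_append List.map_append
          (shift_whisker 0 [] f.word x)
      map₂_whiskerRight := fun η h => by
        induction η using HomSpace.ind with | h x hx =>
        exact HomSpace.heq_mk_of_eq rfl List.map_append List.map_append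
          (shift_whisker 0 h.word [] x) }
  obj_unit A := rfl
  unit_obj A := congrArg Obj.mk (Nat.zero_add A.rank)
  right₁_unit f := OneHom.heq rfl rfl (map_zero_add f.word)
  unit_left₁ {A A'} f := OneHom.heq (congrArg Obj.mk (Nat.zero_add A.rank))
    (congrArg Obj.mk (Nat.zero_add A'.rank)) (map_zero_add f.word)
  right₂_unit {A A' f f'} α := by
    induction α using HomSpace.ind with | h x hx =>
    exact HomSpace.heq_mk_of_eq rfl (map_zero_add f.word) (map_zero_add f'.word) (shift_zero x)
  unit_left₂ {A A' f f'} α := by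
    induction α using HomSpace.ind with | h x hx =>
    exact HomSpace.heq_mk_of_eq (Nat.zero_add A.rank) (map_zero_add f.word)
      (map_zero_add f'.word) (shift_zero x)
  obj_assoc A B X := congrArg Obj.mk (Nat.add_assoc A.rank B.rank X.rank).symm
  left₁_left₁ A B X X' f := OneHom.heq (congrArg Obj.mk (Nat.add_assoc A.rank B.rank X.rank).symm)
    (congrArg Obj.mk (Nat.add_assoc A.rank B.rank X'.rank).symm) (map_add_map_add _ _ f.word)
  left₁_right₁ A X X' f B := OneHom.heq
    (congrArg Obj.mk (Nat.add_assoc A.rank X.rank B.rank).symm)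
    (congrArg Obj.mk (Nat.add_assoc A.rank X'.rank B.rank).symm)
    ((congrArg _ (map_zero_add f.word)).trans (map_zero_add _).symm)
  right₁_right₁ {X X'} f A B := OneHom.heq
    (congrArg Obj.mk (Nat.add_assoc X.rank A.rank B.rank).symm)
    (congrArg Obj.mk (Nat.add_assoc X'.rank A.rank B.rank).symm)
    (map_zero_add (f.word.map (0 + ·))).symm
  left₂_left₂ A B {X X' f f'} α := by
    induction α using HomSpace.ind with | h x hx =>
    exact HomSpace.heq_mk_of_eq (Nat.add_assoc A.rank B.rank X.rank).symm
      (map_add_map_add _ _ f.word) (map_add_map_add _ _ f'.word) (shift_shift _ _ x)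
  left₂_right₂ A {X X' f f'} α B := by
    induction α using HomSpace.ind with | h x hx =>
    exact HomSpace.heq_mk_of_eq (Nat.add_assoc A.rank X.rank B.rank).symm
      ((congrArg _ (map_zero_add f.word)).trans (map_zero_add _).symm)
      ((congrArg _ (map_zero_add f'.word)).trans (map_zero_add _).symm)
      ((congrArg (shift A.rank) (shift_zero x)).trans (shift_zero (shift A.rank x)).symm)
  right₂_right₂ {X X' f f'} α A B := by
    induction α using HomSpace.ind with | h x hx =>
    exact HomSpace.heq_mk_of_eq (Nat.add_assoc X.rank A.rank B.rank).symm
      (map_zero_add (f.word.map (0 + ·))).symm (map_zero_add (f'.word.map (0 + ·))).symm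
      (shift_zero (shift 0 x)).symm
  tensorator_left A {B B' X X'} g h := by
    obtain rfl := g.eq
    refine HomSpace.heq_mk_of_eq (Nat.add_assoc A.rank B.rank X.rank).symm
      (by simp [add_assoc]) (by simp [add_assoc]) ?_ |>.symm
    refine (shift_shuffleCrossing A.rank _ _).trans ?_
    simp [add_assoc, Function.comp_def]
  tensorator_middle {A A'} f B {X X'} h := by
    obtain rfl := f.eq
    refine HomSpace.heq_mk_of_eq (Nat.add_assoc A.rank B.rank X.rank)
      (by simp [add_assoc]) (by simp [add_assoc]) ?_
    simp [add_assoc, Function.comp_def]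
  tensorator_right {A A' B B'} f g X := by
    obtain rfl := f.eq
    refine HomSpace.heq_mk_of_eq (Nat.add_assoc A.rank B.rank X.rank).symm
      (by simp) (by simp) ?_
    refine .trans ?_ (shift_shuffleCrossing 0 _ _).symm
    simp [Function.comp_def]
  right₁_id A B := OneHom.ext rfl
  left₁_id A B := OneHom.ext rfl
  tensorator_id_left A {B B'} g := HomSpace.heq_mk_of_eq rfl (by simp) (by simp) rfl
  tensorator_id_right f B := HomSpace.heq_mk_of_eq rfl (by simp) (by simp)
    (shuffleCrossing_nil_right _)
  tensorator_naturality_left {A A' B B' f f'} α g := by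
    obtain rfl := f.eq
    obtain rfl := g.eq
    induction α using HomSpace.ind with | h x hx =>
    have S := Slides.shift (show 0 + A.rank ≤ A.rank + B.rank by omega) hx f.isColor
      (v := g.word.map (A.rank + ·)) fun j hj => by
        obtain ⟨k, hk, rfl⟩ := List.mem_map.1 hj
        have := g.isColor k hk
        simp only [IsColor] at *
        omega
    exact (HomSpace.mk_eq_mk.2 S.3).symm
  tensorator_naturality_right {A A' B B'} f {g g'} β := by
    obtain rfl := f.eq
    obtain rfl := g.eq
    induction β using HomSpace.ind with | h x hx =>
    have S := Slides.shift (le_refl (A.rank + B.rank)) hx g.isColor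
      (v := f.word.map (0 + ·)) fun j hj => by
        rw [map_zero_add] at hj
        have := f.isColor j hj
        simp only [IsColor] at *
        omega
    exact (HomSpace.mk_eq_mk.2 (S.mirror (far_tensor f.isColor g.isColor).symm
      (far_tensor f.isColor g'.isColor).symm (shift_mem_linDiag le_rfl hx)).3).symm
  tensorator_comp_left {A A' A'' B B'} f f' g := by
    obtain rfl := f.eq
    obtain rfl := f'.eq
    obtain rfl := g.eq
    refine HomSpace.heq_mk_of_eq
      (y := 1 * (whisker (f'.word.map (0 + ·)) [] (shuffleCrossing (f.word.map (0 + ·))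
        (g.word.map (A.rank + ·))) * (1 * (whisker [] (f.word.map (0 + ·)) (shuffleCrossing
        (f'.word.map (0 + ·)) (g.word.map (A.rank + ·))) * 1)))) rfl (by simp) (by simp) ?_
    rw [comp_word, List.map_append, shuffleCrossing_append_left]
    simp only [one_mul, mul_one]
  tensorator_comp_right {A A' B B' B''} f g g' := by
    obtain rfl := f.eq
    obtain rfl := g.eq
    obtain rfl := g'.eq
    have R := rel_shuffleCrossing_append_right (far_tensor f.isColor g'.isColor)
      (far_tensor f.isColor g.isColor)
    refine HomSpace.heq_mk
      (y := 1 * (whisker [] (g.word.map (A.rank + ·)) (shuffleCrossing (f.word.map (0 + ·))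
        (g'.word.map (A.rank + ·))) * (1 * (whisker (g'.word.map (A.rank + ·)) [] (shuffleCrossing
        (f.word.map (0 + ·)) (g.word.map (A.rank + ·))) * 1)))) rfl (by simp) (by simp) ?_
    simpa [Function.comp_def] using R.3

/-! ### Adjoining zero 1-morphisms -/

namespace ZObj

lemma someIso_eqToIso {a b : ZObj} {f g : a.base ⟶ b.base} (h : f = g) :
    someIso (a := a) (b := b) (eqToIso h) =
      eqToIso (show (show a ⟶ b from some f) = some g from congrArg some h) := by
  subst h
  rfl

lemma heq_none {m n m' n' : Obj} (hm : m = m') (hn : n = n') :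
    HEq (none : Option (m ⟶ n)) (none : Option (m' ⟶ n')) := by
  subst hm hn
  rfl

lemma heq_some {m n m' n' : Obj} (hm : m = m') (hn : n = n') {f : m ⟶ n} {g : m' ⟶ n'}
    (h : HEq f g) : HEq (some f) (some g) := by
  subst hm hn
  rw [eq_of_heq h]

instance strict_zObj : Bicategory.Strict ZObj where
  id_comp f := by
    rcases f with _ | f
    exacts [rfl, congrArg some (Bicategory.Strict.id_comp f)]
  comp_id f := by
    rcases f with _ | f
    exacts [rfl, congrArg some (Bicategory.Strict.comp_id f)]
  assoc f g h := by
    rcases f with _ | f <;> rcases g with _ | g <;> rcases h with _ | h <;>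
      first | rfl | exact congrArg some (Bicategory.Strict.assoc f g h)
  leftUnitor_eqToIso f := by
    rcases f with _ | f
    · rfl
    · exact (congrArg someIso (Bicategory.Strict.leftUnitor_eqToIso f)).trans (someIso_eqToIso _)
  rightUnitor_eqToIso f := by
    rcases f with _ | f
    · rfl
    · exact (congrArg someIso (Bicategory.Strict.rightUnitor_eqToIso f)).trans (someIso_eqToIso _)
  associator_eqToIso f g h := by
    rcases f with _ | f <;> rcases g with _ | g <;> rcases h with _ | h <;>
      first
        | rfl
        | exact (congrArg someIso (Bicategory.Strict.associator_eqToIso f g h)).trans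
            (someIso_eqToIso _)

lemma isInternal_bot {M : Type*} [AddCommGroup M] [Module ℂ M] [Subsingleton M] :
    DirectSum.IsInternal (fun _ : ℤ => (⊥ : Submodule ℂ M)) := by
  rw [DirectSum.isInternal_submodule_iff_iSupIndep_and_iSup_eq_top]
  exact ⟨fun _ => disjoint_bot_left, Subsingleton.elim _ _⟩

lemma piece_isInternal {a b : Obj} (f g : Option (a ⟶ b)) : DirectSum.IsInternal (piece f g) := by
  rcases f with _ | f
  · exact isInternal_bot (M := PUnit)
  rcases g with _ | g
  · exact isInternal_bot (M := PUnit)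
  · exact grading_isLocallyGradedLinear.isInternal f g

lemma grading_isLocallyGradedLinear : grading.IsLocallyGradedLinear where
  isInternal f g := piece_isInternal f g
  id_mem f := by
    rcases f with _ | f
    exacts [zero_mem (⊥ : Submodule ℂ PUnit),
      SoergelDiagrammatics.grading_isLocallyGradedLinear.id_mem f]
  comp_mem {a b f g h k l η θ} hη hθ := by
    rcases f with _ | f
    · exact zero_mem (⊥ : Submodule ℂ PUnit)
    rcases h with _ | h
    · exact zero_mem (⊥ : Submodule ℂ PUnit)
    rcases g with _ | g
    · exact zero_mem (SoergelDiagrammatics.grading.piece f h (k + l))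
    · exact SoergelDiagrammatics.grading_isLocallyGradedLinear.comp_mem hη hθ
  whiskerLeft_mem f g h k η hη := by
    rcases f with _ | f <;> rcases g with _ | g <;> rcases h with _ | h <;>
      first
        | exact zero_mem (⊥ : Submodule ℂ PUnit)
        | exact SoergelDiagrammatics.grading_isLocallyGradedLinear.whiskerLeft_mem f hη
  whiskerRight_mem {a b c f g k η} hη h := by
    rcases f with _ | f <;> rcases g with _ | g <;> rcases h with _ | h <;>
      first
        | exact zero_mem (⊥ : Submodule ℂ PUnit)
        | exact SoergelDiagrammatics.grading_isLocallyGradedLinear.whiskerRight_mem hη h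
  whiskerLeft_add f g h η θ := by
    rcases f with _ | f <;> rcases g with _ | g <;> rcases h with _ | h <;>
      first
        | rfl
        | exact SoergelDiagrammatics.grading_isLocallyGradedLinear.whiskerLeft_add f _ _
  whiskerLeft_smul f g h r η := by
    rcases f with _ | f <;> rcases g with _ | g <;> rcases h with _ | h <;>
      first
        | rfl
        | exact SoergelDiagrammatics.grading_isLocallyGradedLinear.whiskerLeft_smul f r _
  add_whiskerRight {a b c f g} η θ h := by
    rcases f with _ | f <;> rcases g with _ | g <;> rcases h with _ | h <;>
      first
        | rfl
        | exact SoergelDiagrammatics.grading_isLocallyGradedLinear.add_whiskerRight _ _ h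
  smul_whiskerRight {a b c f g} r η h := by
    rcases f with _ | f <;> rcases g with _ | g <;> rcases h with _ | h <;>
      first
        | rfl
        | exact SoergelDiagrammatics.grading_isLocallyGradedLinear.smul_whiskerRight r _ h

lemma tensorData_isGradedLinear : tensorData.IsGradedLinear grading where
  left₂_add A B B' g g' β γ := by
    rcases g with _ | g <;> rcases g' with _ | g' <;>
      first | rfl | exact SoergelDiagrammatics.tensorData_isGradedLinear.left₂_add A.base _ _
  left₂_smul A B B' g g' r β := by
    rcases g with _ | g <;> rcases g' with _ | g' <;>
      first | rfl | exact SoergelDiagrammatics.tensorData_isGradedLinear.left₂_smul A.base r _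
  left₂_mem A B B' g g' k β hβ := by
    rcases g with _ | g <;> rcases g' with _ | g' <;>
      first
        | exact zero_mem (⊥ : Submodule ℂ PUnit)
        | exact SoergelDiagrammatics.tensorData_isGradedLinear.left₂_mem A.base hβ
  right₂_add {A A' f f'} α γ B := by
    rcases f with _ | f <;> rcases f' with _ | f' <;>
      first | rfl | exact SoergelDiagrammatics.tensorData_isGradedLinear.right₂_add _ _ B.base
  right₂_smul {A A' f f'} r α B := by
    rcases f with _ | f <;> rcases f' with _ | f' <;>
      first | rfl | exact SoergelDiagrammatics.tensorData_isGradedLinear.right₂_smul r _ B.base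
  right₂_mem {A A' f f' k α} hα B := by
    rcases f with _ | f <;> rcases f' with _ | f' <;>
      first
        | exact zero_mem (⊥ : Submodule ℂ PUnit)
        | exact SoergelDiagrammatics.tensorData_isGradedLinear.right₂_mem hα B.base
  tensorator_mem f g := by
    rcases f with _ | f <;> rcases g with _ | g <;>
      first
        | exact zero_mem (⊥ : Submodule ℂ PUnit)
        | exact SoergelDiagrammatics.tensorData_isGradedLinear.tensorator_mem f g

lemma tensorData_isSemistrictMonoidal : ZObj.tensorData.IsSemistrictMonoidal := by
  have T := SoergelDiagrammatics.tensorData_isSemistrictMonoidal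
  exact
  { isIso_tensorator := fun f g => by
      rcases f with _ | f <;> rcases g with _ | g
      iterate 3 exact ⟨PUnit.unit, rfl, rfl⟩
      obtain ⟨i, h, h'⟩ := T.isIso_tensorator f g
      exact ⟨i, h, h'⟩
    left_twoFunctor := fun A =>
      { map₁_id := fun B => congrArg some ((T.left_twoFunctor A.base).map₁_id B.base)
        map₁_comp := fun f g => by
          rcases f with _ | f <;> rcases g with _ | g <;>
            first | rfl | exact congrArg some ((T.left_twoFunctor A.base).map₁_comp f g)
        map₂_id := fun f => by
          rcases f with _ | f
          exacts [rfl, (T.left_twoFunctor A.base).map₂_id f]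
        map₂_comp := fun {a b f g h} η θ => by
          rcases f with _ | f
          · rfl
          rcases h with _ | h
          · rfl
          rcases g with _ | g
          · exact map_zero (HomSpace.shift A.base.rank (A.base.rank + a.base.rank) le_rfl)
          · exact (T.left_twoFunctor A.base).map₂_comp _ _
        map₂_whiskerLeft := fun f g h η => by
          rcases f with _ | f <;> rcases g with _ | g <;> rcases h with _ | h <;>
            first | rfl | exact (T.left_twoFunctor A.base).map₂_whiskerLeft f _
        map₂_whiskerRight := fun {a b c f g} η h => by
          rcases f with _ | f <;> rcases g with _ | g <;> rcases h with _ | h <;>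
            first | rfl | exact (T.left_twoFunctor A.base).map₂_whiskerRight _ h }
    right_twoFunctor := fun B =>
      { map₁_id := fun A => congrArg some ((T.right_twoFunctor B.base).map₁_id A.base)
        map₁_comp := fun f g => by
          rcases f with _ | f <;> rcases g with _ | g <;>
            first | rfl | exact congrArg some ((T.right_twoFunctor B.base).map₁_comp f g)
        map₂_id := fun f => by
          rcases f with _ | f
          exacts [rfl, (T.right_twoFunctor B.base).map₂_id f]
        map₂_comp := fun {a b f g h} η θ => by
          rcases f with _ | f
          · rfl
          rcases h with _ | h
          · rfl
          rcases g with _ | g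
          · exact map_zero (HomSpace.shift 0 (a.base.rank + B.base.rank) (by omega))
          · exact (T.right_twoFunctor B.base).map₂_comp _ _
        map₂_whiskerLeft := fun f g h η => by
          rcases f with _ | f <;> rcases g with _ | g <;> rcases h with _ | h <;>
            first | rfl | exact (T.right_twoFunctor B.base).map₂_whiskerLeft f _
        map₂_whiskerRight := fun {a b c f g} η h => by
          rcases f with _ | f <;> rcases g with _ | g <;> rcases h with _ | h <;>
            first | rfl | exact (T.right_twoFunctor B.base).map₂_whiskerRight _ h }
    obj_unit := fun A => congrArg ZObj.mk (T.obj_unit A.base)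
    unit_obj := fun A => congrArg ZObj.mk (T.unit_obj A.base)
    right₁_unit := fun f => by
      rcases f with _ | f
      exacts [heq_none (T.obj_unit _) (T.obj_unit _),
        heq_some (T.obj_unit _) (T.obj_unit _) (T.right₁_unit f)]
    unit_left₁ := fun f => by
      rcases f with _ | f
      exacts [heq_none (T.unit_obj _) (T.unit_obj _),
        heq_some (T.unit_obj _) (T.unit_obj _) (T.unit_left₁ f)]
    right₂_unit := fun {A A' f f'} α => by
      rcases f with _ | f <;> rcases f' with _ | f' <;>
        first | rfl | exact T.right₂_unit (f := f) (f' := f') α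
    unit_left₂ := fun {A A' f f'} α => by
      rcases f with _ | f <;> rcases f' with _ | f' <;>
        first | rfl | exact T.unit_left₂ (f := f) (f' := f') α
    obj_assoc := fun A B X => congrArg ZObj.mk (T.obj_assoc A.base B.base X.base)
    left₁_left₁ := fun A B X X' f => by
      rcases f with _ | f
      exacts [heq_none (T.obj_assoc _ _ _) (T.obj_assoc _ _ _),
        heq_some (T.obj_assoc _ _ _) (T.obj_assoc _ _ _) (T.left₁_left₁ A.base B.base f)]
    left₁_right₁ := fun A X X' f B => by
      rcases f with _ | f
      exacts [heq_none (T.obj_assoc _ _ _) (T.obj_assoc _ _ _),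
        heq_some (T.obj_assoc _ _ _) (T.obj_assoc _ _ _) (T.left₁_right₁ A.base f B.base)]
    right₁_right₁ := fun f A B => by
      rcases f with _ | f
      exacts [heq_none (T.obj_assoc _ _ _) (T.obj_assoc _ _ _),
        heq_some (T.obj_assoc _ _ _) (T.obj_assoc _ _ _) (T.right₁_right₁ f A.base B.base)]
    left₂_left₂ := fun A B X X' f f' α => by
      rcases f with _ | f <;> rcases f' with _ | f' <;>
        first | rfl | exact T.left₂_left₂ A.base B.base (f := f) (f' := f') α
    left₂_right₂ := fun A X X' f f' α B => by
      rcases f with _ | f <;> rcases f' with _ | f' <;>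
        first | rfl | exact T.left₂_right₂ A.base (f := f) (f' := f') α B.base
    right₂_right₂ := fun {X X' f f'} α A B => by
      rcases f with _ | f <;> rcases f' with _ | f' <;>
        first | rfl | exact T.right₂_right₂ (f := f) (f' := f') α A.base B.base
    tensorator_left := fun A B B' X X' g h => by
      rcases g with _ | g <;> rcases h with _ | h <;>
        first | rfl | exact T.tensorator_left A.base g h
    tensorator_middle := fun f B X X' h => by
      rcases f with _ | f <;> rcases h with _ | h <;>
        first | rfl | exact T.tensorator_middle f B.base h
    tensorator_right := fun f g X => by
      rcases f with _ | f <;> rcases g with _ | g <;>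
        first | rfl | exact T.tensorator_right f g X.base
    right₁_id := fun A B => congrArg some (T.right₁_id A.base B.base)
    left₁_id := fun A B => congrArg some (T.left₁_id A.base B.base)
    tensorator_id_left := fun A B B' g => by
      rcases g with _ | g
      exacts [HEq.rfl, T.tensorator_id_left A.base g]
    tensorator_id_right := fun f B => by
      rcases f with _ | f
      exacts [HEq.rfl, T.tensorator_id_right f B.base]
    tensorator_naturality_left := fun {A A' B B' f f'} α g => by
      rcases f with _ | f <;> rcases f' with _ | f' <;> rcases g with _ | g <;>
        first | rfl | exact T.tensorator_naturality_left (f := f) (f' := f') α g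
    tensorator_naturality_right := fun {A A' B B'} f {g g'} β => by
      rcases f with _ | f <;> rcases g with _ | g <;> rcases g' with _ | g' <;>
        first | rfl | exact T.tensorator_naturality_right f (g := g) (g' := g') β
    tensorator_comp_left := fun f f' g => by
      rcases f with _ | f <;> rcases f' with _ | f' <;> rcases g with _ | g <;>
        first | rfl | exact T.tensorator_comp_left f f' g
    tensorator_comp_right := fun f g g' => by
      rcases f with _ | f <;> rcases g with _ | g <;> rcases g' with _ | g' <;>
        first | rfl | exact T.tensorator_comp_right f g g' }

end ZObj

end SoergelDiagrammatics

theorem mainTheorem7 :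
    (Bicategory.Strict SoergelDiagrammatics.Obj ∧
      SoergelDiagrammatics.grading.IsLocallyGradedLinear ∧
      SoergelDiagrammatics.tensorData.IsSemistrictMonoidal ∧
      SoergelDiagrammatics.tensorData.IsGradedLinear SoergelDiagrammatics.grading) ∧
    (Bicategory.Strict SoergelDiagrammatics.ZObj ∧
      SoergelDiagrammatics.ZObj.grading.IsLocallyGradedLinear ∧
      SoergelDiagrammatics.ZObj.tensorData.IsSemistrictMonoidal ∧
      SoergelDiagrammatics.ZObj.tensorData.IsGradedLinear SoergelDiagrammatics.ZObj.grading) :=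
  ⟨⟨SoergelDiagrammatics.strict_obj, SoergelDiagrammatics.grading_isLocallyGradedLinear,
    SoergelDiagrammatics.tensorData_isSemistrictMonoidal,
    SoergelDiagrammatics.tensorData_isGradedLinear⟩,
   ⟨SoergelDiagrammatics.ZObj.strict_zObj, SoergelDiagrammatics.ZObj.grading_isLocallyGradedLinear,
    SoergelDiagrammatics.ZObj.tensorData_isSemistrictMonoidal,
    SoergelDiagrammatics.ZObj.tensorData_isGradedLinear⟩⟩
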